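/- Let $N\ge 1$, $\nu_0\in\mathbb R$, let $\alpha_1,\dots,\alpha_N$ be non-zero real numbers with $\alpha_1=1$, and suppose that for every $\nu\in\nu_0+\mathbb N$ (with $0\in\mathbb N$) we are given positive real numbers $c^{(\nu)}$, $d^{(\nu)}$, $\delta^{(\nu)}_1,\dots,\delta^{(\nu)}_N$ such that $$\delta^{(\nu+1)}_k=(d^{(\nu)}k+c^{(\nu)})\,\delta^{(\nu)}_k\quad(1\le k\le N),\qquad \frac{\alpha_{k+1}^2}{\alpha_k^2}=\frac{d^{(\nu)}k(N-k)}{2(d^{(\nu)}k+c^{(\nu)})}\,\frac{\delta^{(\nu)}_{k+1}}{\delta^{(\nu)}_k}\quad(1\le k\le N-1).$$ Let $J=\mathrm{diag}(1,\dots,N)$, $S^\alpha=\mathrm{diag}(\alpha_1,\dots,\alpha_N)$, $\Delta^{(\nu)}=\mathrm{diag}(\delta^{(\nu)}_1,\dots,\delta^{(\nu)}_N)$, $A=2\sum_{j=2}^N E_{j,j-1}$ and $A^\alpha=S^\alpha A(S^\alpha)^{-1}$, where $E_{i,j}$ are the matrix units. Let $L(x)$ be the lower triangular $N\times N$ matrix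 with $L(x)_{m,n}=H_{m-n}(x)/(m-n)!$ for $m\ge n$, where $H_n$ are the Hermite polynomials, $\sum_{n\ge0}H_n(x)t^n/n!=e^{2xt-t^2}$, and put $L^\alpha(x)=S^\alpha L(x)(S^\alpha)^{-1}$ and $$W^{(\alpha,\nu)}(x)=e^{-x^2}L^\alpha(x)\,\Delta^{(\nu)}\,L^\alpha(x)^*,\qquad x\in\mathbb R.$$ Let $\nu\in\nu_0+\mathbb N$. There is a unique sequence $(P^{(\alpha,\nu)}_n)_{n\ge0}$ of polynomials with coefficients in $\mathrm{Mat}_N(\mathbb C)$ such that $P^{(\alpha,\nu)}_n$ is monic of degree $n$ and $\int_{\mathbb R}P^{(\alpha,\nu)}_m(x)W^{(\alpha,\nu)}(x)P^{(\alpha,\nu)}_n(x)^*\,dx=0$ for $m\ne n$. It satisfies $$xP^{(\alpha,\nu)}_n(x)=P^{(\alpha,\nu)}_{n+1}(x)+B^{(\alpha,\nu)}_nP^{(\alpha,\nu)}_n(x)+C^{(\alpha,\nu)}_nP^{(\alpha,\nu)}_{n-1}(x),\qquad n\ge 0,\quad P^{(\alpha,\nu)}_{-1}=0,$$ where the coefficients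 ($B_n^{(\alpha,\nu)}$ for $n\ge0$, $C_n^{(\alpha,\nu)}$ for $n\ge1$) are uniquely determined and are given as follows. For $n\ge1$, $$\begin{aligned}B^{(\alpha,\nu)}_n=\tfrac12A^\alpha&+\tfrac14\Bigl(N+1-J+\tfrac{c^{(\nu+n-1)}}{d^{(\nu+n-1)}}\Bigr)^{-1}\Bigl(N+1-J+\tfrac{c^{(\nu+n)}}{d^{(\nu+n)}}\Bigr)^{-1}\\&\times\Bigl(N+1-J+(n+1)\tfrac{c^{(\nu+n-1)}}{d^{(\nu+n-1)}}-n\tfrac{c^{(\nu+n)}}{d^{(\nu+n)}}\Bigr)J(N-J)\,S^\alpha A^*(S^\alpha)^{-1},\end{aligned}$$ $$\bigl(C^{(\alpha,\nu)}_n\bigr)_{p,q}=\delta_{p,q}\,\frac{-n}{2d^{(\nu+n-1)}}\,\frac{\delta^{(\nu+n)}_1}{\delta^{(\nu+n-1)}_1}\,\frac{\bigl(-N-\frac{c^{(\nu+n)}}{d^{(\nu+n)}}\bigr)_{p-1}}{\bigl(-N-\frac{c^{(\nu+n-1)}}{d^{(\nu+n-1)}}\bigr)_{p}},\qquad 1\le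 p,q\le N,$$ where $(a)_k=a(a+1)\cdots(a+k-1)$. For $n=0$ the two factors in the formula for $B_n^{(\alpha,\nu)}$ that contain $c^{(\nu-1)}/d^{(\nu-1)}$ cancel, and $$B^{(\alpha,\nu)}_0=\tfrac12A^\alpha+\tfrac14\Bigl(N+1-J+\tfrac{c^{(\nu)}}{d^{(\nu)}}\Bigr)^{-1}J(N-J)\,S^\alpha A^*(S^\alpha)^{-1}.$$ In particular, $B^{(\alpha,\nu)}_n$ is tridiagonal with zero diagonal for every $n\ge0$. -/

import Mathlib

noncomputable section

namespace MVHermite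

open Polynomial

/-- The (physicists') Hermite polynomials: `H₀ = 1`, `Hₙ₊₁ = 2 x Hₙ - Hₙ'`. -/
def physHermite : ℕ → Polynomial ℝ
  | 0 => 1
  | n + 1 => 2 * X * physHermite n - derivative (physHermite n)

/-! Rows and columns of the matrices are labelled `1, …, N` in the text; here the index `i : Fin N`
stands for the label `i + 1`. The sequences `α` and `δ` keep the labels `1, …, N`; their values
at other natural numbers play no role. -/

/-- The diagonal matrix `J = diag(1, 2, …, N)`. -/
def matJ (N : ℕ) : Matrix (Fin N) (Fin N) ℂ :=
  Matrix.diagonal fun i => ((i : ℕ) + 1 : ℂ)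

/-- The matrix `A = 2 ∑_{j=2}^N E_{j,j-1}`. -/
def matA (N : ℕ) : Matrix (Fin N) (Fin N) ℂ :=
  Matrix.of fun i j => if (i : ℕ) = (j : ℕ) + 1 then 2 else 0

/-- The diagonal matrix `S^α = diag(α₁, …, α_N)`. -/
def matS (N : ℕ) (α : ℕ → ℝ) : Matrix (Fin N) (Fin N) ℂ :=
  Matrix.diagonal fun i => (α ((i : ℕ) + 1) : ℂ)

/-- The diagonal matrix `Δ = diag(δ₁, …, δ_N)`. -/
def matDelta (N : ℕ) (δ : ℕ → ℝ) : Matrix (Fin N) (Fin N) ℂ :=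
  Matrix.diagonal fun i => (δ ((i : ℕ) + 1) : ℂ)

/-- The lower triangular matrix `L(x)` with entries `H_{m-n}(x) / (m-n)!` for `n ≤ m`. -/
def matL (N : ℕ) (x : ℝ) : Matrix (Fin N) (Fin N) ℂ :=
  Matrix.of fun m n =>
    if n ≤ m then
      (((physHermite ((m : ℕ) - (n : ℕ))).eval x / (((m : ℕ) - (n : ℕ)).factorial : ℝ) : ℝ) : ℂ)
    else 0

/-- `A^α = S^α A (S^α)⁻¹`. -/
def matAα (N : ℕ) (α : ℕ → ℝ) : Matrix (Fin N) (Fin N) ℂ :=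
  matS N α * matA N * (matS N α)⁻¹

/-- `L^α(x) = S^α L(x) (S^α)⁻¹`. -/
def matLα (N : ℕ) (α : ℕ → ℝ) (x : ℝ) : Matrix (Fin N) (Fin N) ℂ :=
  matS N α * matL N x * (matS N α)⁻¹

/-- The matrix weight `W(x) = L^α(x) (e^{-x²} Δ) L^α(x)^*` on the real line. -/
def weight (N : ℕ) (α δ : ℕ → ℝ) (x : ℝ) : Matrix (Fin N) (Fin N) ℂ :=
  matLα N α x * ((Real.exp (-x ^ 2) : ℂ) • matDelta N δ) * (matLα N α x).conjTranspose

/-- The value at the real point `x` of a polynomial with matrix coefficients. -/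
def evalReal {N : ℕ} (P : Polynomial (Matrix (Fin N) (Fin N) ℂ)) (x : ℝ) :
    Matrix (Fin N) (Fin N) ℂ :=
  P.eval (Matrix.scalar (Fin N) (x : ℂ))

/-- The matrix valued form `⟨P, Q⟩ = ∫_ℝ P(x) W(x) Q(x)^* dx`, the integral being taken entrywise. -/
def form {N : ℕ} (W : ℝ → Matrix (Fin N) (Fin N) ℂ)
    (P Q : Polynomial (Matrix (Fin N) (Fin N) ℂ)) : Matrix (Fin N) (Fin N) ℂ :=
  Matrix.of fun i j => ∫ x : ℝ, (evalReal P x * W x * (evalReal Q x).conjTranspose) i j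

/-- `P` is a sequence of monic matrix valued orthogonal polynomials for the weight `W`:
`Pₙ` is monic of degree `n`, and `⟨Pₘ, Pₙ⟩ = 0` for `m ≠ n`. -/
def IsMonicOrthogonal {N : ℕ} (W : ℝ → Matrix (Fin N) (Fin N) ℂ)
    (P : ℕ → Polynomial (Matrix (Fin N) (Fin N) ℂ)) : Prop :=
  (∀ n, (P n).Monic ∧ (P n).natDegree = n) ∧ ∀ m n, m ≠ n → form W (P m) (P n) = 0

/-- The diagonal matrix `N + 1 - J + r`. -/
def shiftJ (N : ℕ) (r : ℝ) : Matrix (Fin N) (Fin N) ℂ :=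
  ((N : ℂ) + 1 + (r : ℂ)) • (1 : Matrix (Fin N) (Fin N) ℂ) - matJ N

/-- The matrix `J (N - J) S^α A^* (S^α)⁻¹`. -/
def matU (N : ℕ) (α : ℕ → ℝ) : Matrix (Fin N) (Fin N) ℂ :=
  matJ N * ((N : ℂ) • (1 : Matrix (Fin N) (Fin N) ℂ) - matJ N) *
    (matS N α * (matA N).conjTranspose * (matS N α)⁻¹)

end MVHermite

end

/-! Write W^{(ν)} = e^{-x²} M_ν with M_ν a matrix polynomial (`weight_eq`); all integrals then
reduce to the Gaussian moment functional `gaussInt`. The hypotheses on δ and α yield Pearson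
equations between consecutive weights: M_{ν+1} = Φ M_ν and M_{ν+1}' - 2x M_{ν+1} = Ψ M_ν with Φ, Ψ
of degree at most one (`polyM_shift`, `polyM_pearson`). They come from L^α = exp(xA - A²/4), A =
A^α, together with the commutators of A with J and with U = `matU`.

Integration by parts makes Q ↦ Q'Φ + QΨ minus the adjoint of d/dx (`gaussInt_raise`). After
normalisation it carries the monic orthogonal polynomial of degree n at ν+1 to the one of degree n+1
at ν, so P_n arises from the constant 1 at ν+n after n steps (`isOrthoSeq_step`). The same recursion
reduces the squared norms H_n to zeroth moments, which are diagonal and explicitly related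
(`momentDiag_succ`, `momentDiag_shift`), and shows that the subleading coefficient of P_n is -n
B_0^{(ν+n-1)} (`coeff_raisedPoly`).

Invertibility of the H_n gives uniqueness and the three-term recurrence: B_n is a difference of
consecutive subleading coefficients and C_n = H_n H_{n-1}⁻¹ (`three_term_iff`). For N > 1 the
hypotheses force c/d to grow by 1 with ν (`ratio_succ`), which is what makes these formulas collapse
to the stated ones. -/

noncomputable section

namespace MVHermite

open Polynomial MeasureTheory

/-! ### Moments of the Gaussian weight -/

/-- The moment `∫ xᵏ e^{-x²} dx`. -/
def gaussMoment (k : ℕ) : ℝ := ∫ x : ℝ, x ^ k * Real.exp (-x ^ 2)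

lemma integrable_pow_mul_gauss (k : ℕ) :
    Integrable fun x : ℝ => x ^ k * Real.exp (-x ^ 2) := by
  have h := integrable_rpow_mul_exp_neg_mul_sq (b := 1) one_pos (s := (k : ℝ))
    (by have : (0 : ℝ) ≤ k := k.cast_nonneg
        linarith)
  simpa [Real.rpow_natCast] using h

lemma gaussMoment_zero_pos : 0 < gaussMoment 0 := by
  have h := integral_gaussian 1
  simp only [gaussMoment, pow_zero, one_mul]
  simp only [neg_mul, one_mul, div_one] at h
  rw [h]
  exact Real.sqrt_pos.2 Real.pi_pos

/-- The derivative of x^k e^{-x²} has integral zero. At k = 0 the truncated k - 1 carries the factor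
0, and the first moment is seen to vanish. -/
lemma gaussMoment_step (k : ℕ) : (k : ℝ) * gaussMoment (k - 1) = 2 * gaussMoment (k + 1) := by
  have hd : ∀ x : ℝ, HasDerivAt (fun x : ℝ => x ^ k * Real.exp (-x ^ 2))
      (k * (x ^ (k - 1) * Real.exp (-x ^ 2)) - 2 * (x ^ (k + 1) * Real.exp (-x ^ 2))) x := by
    intro x
    have h := (hasDerivAt_pow k x).mul (((hasDerivAt_pow 2 x).neg).exp)
    refine h.congr_deriv ?_
    simp only [Pi.neg_apply]
    push_cast
    ring
  have h1 := ((integrable_pow_mul_gauss (k - 1)).const_mul (k : ℝ))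
  have h2 := ((integrable_pow_mul_gauss (k + 1)).const_mul (2 : ℝ))
  have h0 := integral_eq_zero_of_hasDerivAt_of_integrable hd (h1.sub h2)
    (integrable_pow_mul_gauss k)
  rw [integral_sub h1 h2, integral_const_mul, integral_const_mul] at h0
  exact sub_eq_zero.1 h0

variable {N : ℕ}

/-- The square matrices of size `N`. -/
local notation "Mat" N => Matrix (Fin N) (Fin N) ℂ

/-- The functional `F ↦ ∫ F(x) e^{-x²} dx` on polynomials with matrix coefficients. -/
def gaussInt : Polynomial (Mat N) →ₗ[ℂ] Mat N :=
  Polynomial.lsum fun k => (gaussMoment k : ℂ) • LinearMap.id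

lemma gaussInt_monomial (k : ℕ) (a : Mat N) :
    gaussInt (monomial k a) = (gaussMoment k : ℂ) • a := by
  simp [gaussInt, Polynomial.lsum_apply, Polynomial.sum_monomial_index]

lemma gaussInt_C (a : Mat N) : gaussInt (C a) = (gaussMoment 0 : ℂ) • a := by
  rw [← monomial_zero_left, gaussInt_monomial]

lemma gaussInt_C_mul (a : Mat N) (F : Polynomial (Mat N)) :
    gaussInt (C a * F) = a * gaussInt F := by
  induction F using Polynomial.induction_on' with
  | add p q hp hq => simp only [mul_add, map_add, hp, hq]
  | monomial k b => simp [C_mul_monomial, gaussInt_monomial]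

lemma gaussInt_mul_C (a : Mat N) (F : Polynomial (Mat N)) :
    gaussInt (F * C a) = gaussInt F * a := by
  induction F using Polynomial.induction_on' with
  | add p q hp hq => simp only [add_mul, map_add, hp, hq]
  | monomial k b => simp [monomial_mul_C, gaussInt_monomial]

lemma gaussInt_derivative (F : Polynomial (Mat N)) :
    gaussInt (derivative F) = (2 : ℂ) • gaussInt (X * F) := by
  induction F using Polynomial.induction_on' with
  | add p q hp hq => simp only [mul_add, map_add, hp, hq, smul_add]
  | monomial k b =>
    have h := congrArg (fun r : ℝ => (r : ℂ)) (gaussMoment_step k)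
    push_cast at h
    rw [derivative_monomial, gaussInt_monomial, X_mul_monomial, gaussInt_monomial, smul_smul, ← h,
      mul_comm (k : ℂ), mul_smul, ← nsmul_eq_mul', ← Nat.cast_smul_eq_nsmul ℂ]

/-! ### The adjoint of a polynomial with matrix coefficients -/

/-- The coefficientwise conjugate transpose. -/
def adj (F : Polynomial (Mat N)) : Polynomial (Mat N) :=
  -- Conjugate transposition reverses products, so it is a ring isomorphism onto the opposite ring;
  -- `opRingEquiv` moves the opposite outside the polynomials.
  ((opRingEquiv (Mat N)).symm (F.map (starRingEquiv (R := Mat N)).toRingHom)).unop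

lemma adj_add (F G : Polynomial (Mat N)) : adj (F + G) = adj F + adj G := by
  simp [adj]

lemma adj_sub (F G : Polynomial (Mat N)) : adj (F - G) = adj F - adj G := by
  simp [adj]

lemma adj_mul (F G : Polynomial (Mat N)) : adj (F * G) = adj G * adj F := by
  simp [adj]

lemma adj_sum {ι : Type*} (s : Finset ι) (F : ι → Polynomial (Mat N)) :
    adj (∑ i ∈ s, F i) = ∑ i ∈ s, adj (F i) := by
  simp [adj, Polynomial.map_sum]

lemma adj_monomial (k : ℕ) (a : Mat N) : adj (monomial k a) = monomial k (star a) := by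
  simp [adj]

@[simp] lemma adj_C (a : Mat N) : adj (C a) = C (star a) := adj_monomial 0 a

@[simp] lemma adj_X_pow (k : ℕ) : adj (X ^ k : Polynomial (Mat N)) = X ^ k := by
  simp only [X_pow_eq_monomial, adj_monomial, star_one]

lemma adj_derivative (F : Polynomial (Mat N)) : adj (derivative F) = derivative (adj F) := by
  induction F using Polynomial.induction_on' with
  | add p q hp hq => simp only [map_add, adj_add, hp, hq]
  | monomial k b => simp [derivative_monomial, adj_monomial, (Nat.cast_commute k (star b)).eq]

lemma adj_adj (F : Polynomial (Mat N)) : adj (adj F) = F := by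
  induction F using Polynomial.induction_on' with
  | add p q hp hq => simp only [adj_add, hp, hq]
  | monomial k b => simp [adj_monomial]

lemma gaussInt_adj (F : Polynomial (Mat N)) : gaussInt (adj F) = star (gaussInt F) := by
  induction F using Polynomial.induction_on' with
  | add p q hp hq => simp only [adj_add, map_add, star_add, hp, hq]
  | monomial k b =>
    rw [adj_monomial, gaussInt_monomial, gaussInt_monomial, star_smul]
    simp

/-! ### Evaluation at real points -/

lemma commute_scalar (x : ℝ) (a : Mat N) : Commute a (Matrix.scalar (Fin N) (x : ℂ)) :=
  (Matrix.scalar_commute (x : ℂ) (fun _ => Commute.all _ _) a).symm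

lemma evalReal_add (F G : Polynomial (Mat N)) (x : ℝ) :
    evalReal (F + G) x = evalReal F x + evalReal G x := eval_add

/-- Multiplicativity holds over a noncommutative ring because the evaluation point is a scalar
matrix. -/
lemma evalReal_mul (F G : Polynomial (Mat N)) (x : ℝ) :
    evalReal (F * G) x = evalReal F x * evalReal G x :=
  eval₂_mul_noncomm _ _ fun _ => commute_scalar x _

lemma evalReal_C (a : Mat N) (x : ℝ) : evalReal (C a) x = a := eval_C

lemma evalReal_monomial (k : ℕ) (a : Mat N) (x : ℝ) :
    evalReal (monomial k a) x = ((x ^ k : ℝ) : ℂ) • a := by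
  rw [evalReal, eval_monomial, ← map_pow]
  ext i j
  simp [Matrix.scalar_apply, Matrix.mul_diagonal, mul_comm]

lemma evalReal_adj (F : Polynomial (Mat N)) (x : ℝ) :
    evalReal (adj F) x = (evalReal F x).conjTranspose := by
  induction F using Polynomial.induction_on' with
  | add p q hp hq => simp only [adj_add, evalReal_add, Matrix.conjTranspose_add, hp, hq]
  | monomial k b =>
    rw [adj_monomial, evalReal_monomial, evalReal_monomial, Matrix.conjTranspose_smul]
    simp [Matrix.star_eq_conjTranspose]

lemma integral_gauss_mul_evalReal (F : Polynomial (Mat N)) (i j : Fin N) :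
    Integrable (fun x : ℝ => (Real.exp (-x ^ 2) : ℂ) * evalReal F x i j) ∧
      ∫ x : ℝ, (Real.exp (-x ^ 2) : ℂ) * evalReal F x i j = gaussInt F i j := by
  induction F using Polynomial.induction_on' with
  | add p q hp hq =>
    simp only [evalReal_add, Matrix.add_apply, mul_add, map_add]
    exact ⟨hp.1.add hq.1, by rw [integral_add hp.1 hq.1, hp.2, hq.2]⟩
  | monomial k b =>
    have h : (fun x : ℝ => (Real.exp (-x ^ 2) : ℂ) * evalReal (monomial k b) x i j) =
        fun x : ℝ => ((x ^ k * Real.exp (-x ^ 2) : ℝ) : ℂ) * b i j := by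
      funext x
      rw [evalReal_monomial, Matrix.smul_apply, smul_eq_mul]
      push_cast
      ring
    rw [h]
    refine ⟨((integrable_pow_mul_gauss k).ofReal).mul_const _, ?_⟩
    rw [integral_mul_const, integral_complex_ofReal, gaussInt_monomial]
    rfl

/-- The form of the weight `e^{-x²} M(x)`, for a matrix polynomial `M`. -/
lemma form_eq_gaussInt {W : ℝ → Mat N} {M : Polynomial (Mat N)}
    (hW : ∀ x, W x = (Real.exp (-x ^ 2) : ℂ) • evalReal M x) (P Q : Polynomial (Mat N)) :
    form W P Q = gaussInt (P * M * adj Q) := by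
  ext i j
  rw [← (integral_gauss_mul_evalReal _ i j).2]
  simp only [form, Matrix.of_apply, hW, evalReal_mul, evalReal_adj, Matrix.mul_smul,
    Matrix.smul_mul, Matrix.smul_apply, smul_eq_mul]

end MVHermite

end

noncomputable section

namespace MVHermite

open Polynomial MeasureTheory

variable {N : ℕ}

local notation "Mat" N => Matrix (Fin N) (Fin N) ℂ

/-! ### Monic orthogonal polynomials -/

/-- `Q` has degree `n` and leading coefficient `1`, in terms of coefficients. -/
def MonicOfDegree (n : ℕ) (Q : Polynomial (Mat N)) : Prop :=
  Q.coeff n = 1 ∧ ∀ k, n < k → Q.coeff k = 0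

lemma monicOfDegree_iff [Nontrivial (Mat N)] {n : ℕ} {Q : Polynomial (Mat N)} :
    MonicOfDegree n Q ↔ Q.Monic ∧ Q.natDegree = n := by
  constructor
  · rintro ⟨h1, h2⟩
    have hd : Q.natDegree = n :=
      le_antisymm (natDegree_le_iff_coeff_eq_zero.2 h2)
        (le_natDegree_of_ne_zero (by rw [h1]; exact one_ne_zero))
    exact ⟨by rw [Monic, leadingCoeff, hd, h1], hd⟩
  · rintro ⟨h1, rfl⟩
    exact ⟨h1, fun k hk => coeff_eq_zero_of_natDegree_lt hk⟩

lemma eq_sum_of_coeff_eq_zero {n : ℕ} {Q : Polynomial (Mat N)}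
    (hQ : ∀ k, n ≤ k → Q.coeff k = 0) :
    Q = ∑ k ∈ Finset.range n, C (Q.coeff k) * X ^ k := by
  ext1 m
  simp only [finsetSum_coeff, coeff_C_mul, coeff_X_pow, mul_ite, mul_one, mul_zero,
    Finset.sum_ite_eq, Finset.mem_range]
  split_ifs with h
  · rfl
  · exact hQ m (not_lt.1 h)

lemma gaussInt_mul_adj_eq_zero {M F Q : Polynomial (Mat N)} {n : ℕ}
    (hF : ∀ k < n, gaussInt (F * M * X ^ k) = 0) (hQ : ∀ k, n ≤ k → Q.coeff k = 0) :
    gaussInt (F * M * adj Q) = 0 := by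
  rw [eq_sum_of_coeff_eq_zero hQ, adj_sum, Finset.mul_sum, map_sum]
  refine Finset.sum_eq_zero fun k hk => ?_
  rw [adj_mul, adj_C, adj_X_pow, ← mul_assoc, gaussInt_mul_C, hF k (Finset.mem_range.1 hk),
    zero_mul]

lemma gaussInt_mul_adj_monic {M F Q : Polynomial (Mat N)} {n : ℕ}
    (hF : ∀ k < n, gaussInt (F * M * X ^ k) = 0) (hQ : MonicOfDegree n Q) :
    gaussInt (F * M * adj Q) = gaussInt (F * M * X ^ n) := by
  have h0 : gaussInt (F * M * adj (Q - X ^ n)) = 0 := by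
    refine gaussInt_mul_adj_eq_zero hF fun k hk => ?_
    rcases hk.eq_or_lt with rfl | hk
    · simp [hQ.1]
    · simp [hQ.2 k hk, coeff_X_pow, hk.ne']
  rwa [adj_sub, adj_X_pow, mul_sub, map_sub, sub_eq_zero] at h0

/-- `P` is a sequence of monic polynomials, `Pₙ` is orthogonal to all polynomials of lower degree
with respect to `e^{-x²} M(x)`, and its squared norm `Hₙ` is invertible. -/
structure IsOrthoSeq (M : Polynomial (Mat N)) (P : ℕ → Polynomial (Mat N)) (H : ℕ → Mat N) :
    Prop where
  monic : ∀ n, MonicOfDegree n (P n)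
  ortho : ∀ n, ∀ k < n, gaussInt (P n * M * X ^ k) = 0
  norm : ∀ n, gaussInt (P n * M * X ^ n) = H n
  unit : ∀ n, IsUnit (H n)

namespace IsOrthoSeq

variable {M : Polynomial (Mat N)} {P : ℕ → Polynomial (Mat N)} {H : ℕ → Mat N}

/-- Descent on the degree: write F = aP_m + G with G of degree below m. Pairing with P_m kills F by
hypothesis and G by Hermitian symmetry, leaving a H_m = 0, so a = 0. No positivity of the weight is
needed. -/
lemma eq_zero_of_ortho (h : IsOrthoSeq M P H) (hM : adj M = M) {n : ℕ} {F : Polynomial (Mat N)}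
    (hd : ∀ k, n ≤ k → F.coeff k = 0) (ho : ∀ k < n, gaussInt (F * M * X ^ k) = 0) : F = 0 := by
  suffices key : ∀ m ≤ n, (∀ k, m ≤ k → F.coeff k = 0) → F = 0 from key n le_rfl hd
  intro m
  induction m with
  | zero => exact fun _ h0 => Polynomial.ext fun k => h0 k k.zero_le
  | succ m ih =>
    intro hm hF
    refine ih (by omega) fun k hk => ?_
    rcases hk.eq_or_lt with rfl | hk
    swap
    · exact hF k hk
    set G := F - C (F.coeff m) * P m with hG
    have hG0 : ∀ k, m ≤ k → G.coeff k = 0 := by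
      intro k hk
      rcases hk.eq_or_lt with rfl | hk
      · simp [hG, (h.monic m).1]
      · simp [hG, (h.monic m).2 k hk, hF k hk]
    have h1 : gaussInt (F * M * adj (P m)) = 0 :=
      gaussInt_mul_adj_eq_zero (n := m + 1) (fun k hk => ho k (by omega))
        fun k hk => (h.monic m).2 k hk
    have h2 : gaussInt (G * M * adj (P m)) = 0 := by
      have h3 : gaussInt (P m * M * adj G) = 0 := gaussInt_mul_adj_eq_zero (h.ortho m) hG0
      have h4 := congrArg star h3
      rwa [← gaussInt_adj, adj_mul, adj_mul, adj_adj, hM, star_zero, ← mul_assoc] at h4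
    have h5 : gaussInt (P m * M * adj (P m)) = H m := by
      rw [gaussInt_mul_adj_monic (h.ortho m) (h.monic m), h.norm]
    have h6 : F = C (F.coeff m) * P m + G := by rw [hG]; abel
    rw [h6, add_mul, add_mul, map_add, h2, add_zero, mul_assoc, mul_assoc, gaussInt_C_mul,
      ← mul_assoc, h5] at h1
    exact (h.unit m).mul_left_eq_zero.1 h1

lemma eq_of_ortho (h : IsOrthoSeq M P H) (hM : adj M = M) {n : ℕ} {Q : Polynomial (Mat N)}
    (hQ : MonicOfDegree n Q) (ho : ∀ k < n, gaussInt (Q * M * X ^ k) = 0) : Q = P n := by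
  rw [← sub_eq_zero]
  refine h.eq_zero_of_ortho hM (n := n) (fun k hk => ?_) fun k hk => ?_
  · rcases hk.eq_or_lt with rfl | hk
    · rw [coeff_sub, hQ.1, (h.monic n).1, sub_self]
    · rw [coeff_sub, hQ.2 k hk, (h.monic n).2 k hk, sub_self]
  · rw [sub_mul, sub_mul, map_sub, ho k hk, h.ortho n k hk, sub_self]

lemma isMonicOrthogonal [Nontrivial (Mat N)] (h : IsOrthoSeq M P H) (hM : adj M = M)
    {W : ℝ → Mat N} (hW : ∀ x, W x = (Real.exp (-x ^ 2) : ℂ) • evalReal M x) :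
    IsMonicOrthogonal W P := by
  refine ⟨fun n => monicOfDegree_iff.1 (h.monic n), ?_⟩
  have key : ∀ m n, n < m → gaussInt (P m * M * adj (P n)) = 0 := fun m n hmn =>
    gaussInt_mul_adj_eq_zero (h.ortho m) fun k hk => (h.monic n).2 k (by omega)
  intro m n hmn
  rw [form_eq_gaussInt hW]
  rcases hmn.lt_or_gt with hlt | hlt
  · have h4 := congrArg star (key n m hlt)
    rwa [← gaussInt_adj, adj_mul, adj_mul, adj_adj, hM, star_zero, ← mul_assoc] at h4
  · exact key m n hlt

/-- Mutual orthogonality is turned into orthogonality to powers by strong induction: once the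
pairings of Q_n with lower powers vanish, its pairing with x^k equals its pairing with the monic
Q_k. -/
lemma eq_of_isMonicOrthogonal [Nontrivial (Mat N)] (h : IsOrthoSeq M P H) (hM : adj M = M)
    {W : ℝ → Mat N} (hW : ∀ x, W x = (Real.exp (-x ^ 2) : ℂ) • evalReal M x)
    {Q : ℕ → Polynomial (Mat N)} (hQ : IsMonicOrthogonal W Q) : Q = P := by
  obtain ⟨hmon, hort⟩ := hQ
  funext n
  have hm : ∀ n, MonicOfDegree n (Q n) := fun n => monicOfDegree_iff.2 (hmon n)
  refine h.eq_of_ortho hM (hm n) fun k hk => ?_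
  induction k using Nat.strong_induction_on with
  | _ k ih =>
    rw [← gaussInt_mul_adj_monic (fun j hj => ih j hj (hj.trans hk)) (hm k),
      ← form_eq_gaussInt hW]
    exact hort n k hk.ne'

/-- The three-term recurrence relation. -/
lemma three_term (h : IsOrthoSeq M P H) (hM : adj M = M) (n : ℕ) :
    X * P (n + 1) = P (n + 2) + C ((P (n + 1)).coeff n - (P (n + 2)).coeff (n + 1)) * P (n + 1) +
      C (H (n + 1) * (H n)⁻¹) * P n := by
  set B := (P (n + 1)).coeff n - (P (n + 2)).coeff (n + 1) with hB
  rw [← sub_eq_zero]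
  -- The difference of the two sides has degree at most n, since B cancels its coefficient of
  -- x^{n+1}; the pairings with x^k for k < n vanish automatically, and the one with x^n vanishes by
  -- the choice of H_{n+1} H_n⁻¹.
  refine h.eq_zero_of_ortho hM (n := n + 1) (fun k hk => ?_) fun k hk => ?_
  · obtain ⟨k, rfl⟩ : ∃ l, k = l + 1 := ⟨k - 1, by omega⟩
    rw [coeff_sub, coeff_add, coeff_add, coeff_X_mul, coeff_C_mul, coeff_C_mul,
      (h.monic n).2 (k + 1) (by omega)]
    rcases (Nat.succ_le_succ_iff.1 hk).eq_or_lt with rfl | hk1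
    · rw [(h.monic (n + 1)).1, hB]
      simp
    · rw [(h.monic (n + 1)).2 (k + 1) (by omega)]
      rcases (Nat.succ_le_of_lt hk1).eq_or_lt with rfl | hk2
      · rw [Nat.succ_eq_add_one, (h.monic (n + 1)).1, (h.monic (n + 2)).1]
        simp
      · rw [(h.monic (n + 1)).2 k (by omega), (h.monic (n + 2)).2 (k + 1) (by omega)]
        simp
  · have h1 : X * P (n + 1) * M * X ^ k = P (n + 1) * M * X ^ (k + 1) := by
      rw [mul_assoc, mul_assoc, X_mul, pow_succ, mul_assoc, mul_assoc, mul_assoc]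
    have h2 : gaussInt (C B * P (n + 1) * M * X ^ k) = 0 := by
      rw [mul_assoc, mul_assoc, gaussInt_C_mul, ← mul_assoc, h.ortho (n + 1) k hk, mul_zero]
    rw [sub_mul, sub_mul, add_mul, add_mul, add_mul, add_mul, map_sub, map_add, map_add, h1, h2,
      h.ortho (n + 2) k (by omega), mul_assoc (C _), mul_assoc (C _), gaussInt_C_mul]
    rcases (Nat.lt_succ_iff.1 hk).eq_or_lt with rfl | hk1
    · rw [h.norm (k + 1), h.norm k, Matrix.mul_assoc, Matrix.nonsing_inv_mul _
        ((Matrix.isUnit_iff_isUnit_det _).1 (h.unit k))]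
      simp
    · rw [h.ortho (n + 1) (k + 1) (by omega), h.ortho n k hk1]
      simp

lemma three_term_iff (h : IsOrthoSeq M P H) (hM : adj M = M) (n : ℕ) (B D : Mat N) :
    X * P (n + 1) = P (n + 2) + C B * P (n + 1) + C D * P n ↔
      B = (P (n + 1)).coeff n - (P (n + 2)).coeff (n + 1) ∧ D = H (n + 1) * (H n)⁻¹ := by
  constructor
  · intro e
    have hB : B = (P (n + 1)).coeff n - (P (n + 2)).coeff (n + 1) := by
      have e1 := congrArg (fun F => F.coeff (n + 1)) e
      simp only [coeff_X_mul, coeff_add, coeff_C_mul, (h.monic n).2 (n + 1) (by omega),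
        (h.monic (n + 1)).1, mul_one, mul_zero, add_zero] at e1
      rw [e1]
      abel
    refine ⟨hB, ?_⟩
    rw [h.three_term hM n, ← hB] at e
    have e1 := congrArg (fun F => F.coeff n) (add_left_cancel e)
    simp only [coeff_C_mul, (h.monic n).1, mul_one] at e1
    exact e1.symm
  · rintro ⟨rfl, rfl⟩
    exact h.three_term hM n

lemma eq_one (h : IsOrthoSeq M P H) : P 0 = 1 := by
  ext1 k
  rcases k.eq_zero_or_pos with rfl | hk
  · simp [(h.monic 0).1]
  · simp [(h.monic 0).2 k hk, coeff_one, hk.ne']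

lemma two_term_iff (h : IsOrthoSeq M P H) (B : Mat N) :
    X * P 0 = P 1 + C B * P 0 ↔ B = -(P 1).coeff 0 := by
  rw [h.eq_one, mul_one, mul_one]
  constructor
  · intro e
    have e1 := congrArg (fun F => F.coeff 0) e
    simp only [coeff_X_zero, coeff_add, coeff_C_zero] at e1
    exact eq_neg_of_add_eq_zero_right e1.symm
  · rintro rfl
    ext1 k
    rcases k with _ | _ | k
    · simp
    · simp [(h.monic 1).1]
    · simp [(h.monic 1).2 (k + 1 + 1) (by omega), coeff_X]

end IsOrthoSeq

end MVHermite

end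

noncomputable section

namespace MVHermite

open Polynomial MeasureTheory

/-! ### Hermite polynomials -/

lemma derivative_physHermite (n : ℕ) :
    derivative (physHermite (n + 1)) = C (2 * (n + 1 : ℝ)) * physHermite n := by
  induction n with
  | zero =>
    simp only [physHermite, derivative_one, sub_zero, mul_one, derivative_mul, derivative_X]
    simp
    rfl
  | succ n ih =>
    have h : physHermite (n + 2) = 2 * X * physHermite (n + 1) - derivative (physHermite (n + 1)) :=
      rfl
    have h' : physHermite (n + 1) = 2 * X * physHermite n - derivative (physHermite n) := rfl
    have h2 : derivative (2 * X : ℝ[X]) = 2 := by simp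
    rw [h, derivative_sub, derivative_mul, h2, ih, derivative_C_mul]
    conv_rhs => rw [h']
    conv_lhs => rw [h']
    simp only [map_mul, map_add, map_natCast, C_1, Nat.cast_add, Nat.cast_one]
    have h3 : (C (2 : ℝ) : ℝ[X]) = 2 := rfl
    rw [h3]
    ring

/-- `Hₙ / (n! 2ⁿ)`. -/
def scaledHermite (n : ℕ) : ℝ[X] := C ((n.factorial * 2 ^ n : ℝ)⁻¹) * physHermite n

lemma scaledHermite_zero : scaledHermite 0 = 1 := by simp [scaledHermite, physHermite]

lemma scaledHermite_one : scaledHermite 1 = X := by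
  simp only [scaledHermite, physHermite, derivative_one, sub_zero, mul_one, Nat.factorial_one,
    Nat.cast_one, one_mul, pow_one]
  rw [← mul_assoc, show (2 : ℝ[X]) = C 2 from rfl, ← C_mul]
  simp

lemma derivative_scaledHermite (n : ℕ) :
    derivative (scaledHermite (n + 1)) = scaledHermite n := by
  rw [scaledHermite, derivative_C_mul, derivative_physHermite, ← mul_assoc, ← C_mul, scaledHermite]
  congr 2
  rw [Nat.factorial_succ]
  have := n.factorial_ne_zero
  push_cast
  field_simp
  ring

lemma scaledHermite_rec (n : ℕ) :
    ((n + 2 : ℕ) : ℝ[X]) * scaledHermite (n + 2) =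
      X * scaledHermite (n + 1) - C (1 / 2 : ℝ) * scaledHermite n := by
  have h : physHermite (n + 2) = 2 * X * physHermite (n + 1) - derivative (physHermite (n + 1)) :=
    rfl
  have hf := n.factorial_ne_zero
  have e1 : C ((n + 2 : ℕ) : ℝ) * C (((n + 2).factorial * 2 ^ (n + 2) : ℝ)⁻¹) * C 2 =
      C (((n + 1).factorial * 2 ^ (n + 1) : ℝ)⁻¹) := by
    rw [← C_mul, ← C_mul, Nat.factorial_succ (n + 1)]
    congr 1
    push_cast
    field_simp
    ring
  have e2 : C ((n + 2 : ℕ) : ℝ) * C (((n + 2).factorial * 2 ^ (n + 2) : ℝ)⁻¹) *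
      C (2 * (n + 1 : ℝ)) = C (1 / 2) * C ((n.factorial * 2 ^ n : ℝ)⁻¹) := by
    rw [← C_mul, ← C_mul, ← C_mul, Nat.factorial_succ (n + 1), Nat.factorial_succ n]
    congr 1
    push_cast
    field_simp
    ring
  rw [← C_eq_natCast, scaledHermite, scaledHermite, scaledHermite, h, derivative_physHermite,
    ← mul_assoc, mul_sub, ← mul_assoc, ← mul_assoc _ (C (2 * (n + 1 : ℝ))), e2,
    show (2 : ℝ[X]) = C 2 from rfl, ← mul_assoc _ (C 2 : ℝ[X]), e1]
  ring

/-! ### Power series in a nilpotent element -/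

section Nilpotent

variable {𝕜 S : Type*} [CommRing 𝕜] [Ring S] [Algebra 𝕜 S]

/-- `∑_{n < N} gₙ aⁿ`. -/
def powSum (N : ℕ) (a : S) (g : ℕ → 𝕜) : S := ∑ n ∈ Finset.range N, g n • a ^ n

variable {N : ℕ} {a J U K : S}

/-- Multiplication by a shifts the coefficients; the term pushed out of the range is a multiple of
a^N = 0. -/
lemma mul_powSum (ha : a ^ N = 0) (g g' : ℕ → 𝕜) (h0 : g' 0 = 0) (h1 : ∀ n, g' (n + 1) = g n) :
    a * powSum N a g = powSum N a g' := by
  have h : powSum N a g' = ∑ n ∈ Finset.range (N + 1), g' n • a ^ n := by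
    rw [Finset.sum_range_succ, ha, smul_zero, add_zero, powSum]
  rw [h, Finset.sum_range_succ', h0, zero_smul, add_zero, powSum, Finset.mul_sum]
  simp only [h1, mul_smul_comm, pow_succ']

lemma powSum_comb (g g' : ℕ → 𝕜) (x y : 𝕜) :
    powSum N a (fun n => x * g n + y * g' n) = x • powSum N a g + y • powSum N a g' := by
  simp only [powSum, Finset.smul_sum, ← Finset.sum_add_distrib, add_smul, mul_smul]

lemma comm_pow_of_comm (hJ : J * a = a * J + a) (n : ℕ) :
    J * a ^ n = a ^ n * J + (n : ℕ) • a ^ n := by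
  induction n with
  | zero => simp
  | succ n ih =>
    rw [pow_succ, ← mul_assoc, ih, add_mul, mul_assoc, hJ, succ_nsmul, mul_add, smul_mul_assoc,
      mul_assoc]
    abel

/-- The commutator of a^{n+1} with U is the sum of a^{n-j} K a^j over j ≤ n; moving K to the right
costs 8j a^n in each term, in total 4n(n+1) a^n. -/
lemma pow_comm_of_comm (hU : a * U = U * a + K) (hK : K * a = a * K + 8 • a) (n : ℕ) :
    a ^ (n + 1) * U = U * a ^ (n + 1) + (n + 1) • (a ^ n * K) + (4 * ((n + 1) * n)) • a ^ n := by
  induction n with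
  | zero => simp [hU]
  | succ n ih =>
    have h1 : a ^ n * K * a = a ^ (n + 1) * K + 8 • a ^ (n + 1) := by
      rw [mul_assoc, hK, mul_add, ← mul_assoc, ← pow_succ, mul_smul_comm, ← pow_succ]
    rw [pow_succ _ (n + 1), mul_assoc, hU, mul_add, ← mul_assoc, ih, add_mul, add_mul,
      smul_mul_assoc, smul_mul_assoc, h1, ← pow_succ a n, mul_assoc, ← pow_succ]
    simp only [← Nat.cast_smul_eq_nsmul ℤ]
    push_cast
    module

variable {g : ℕ → 𝕜} {x h : 𝕜}

/-- The recurrence for g is the equation G' = (x - ht)G for the generating function G(t) = ∑ g_n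
t^n, here evaluated at t = a. -/
lemma powSum_succ (ha : a ^ N = 0) (hg1 : g 1 = x * g 0)
    (hg : ∀ n : ℕ, ((n + 2 : ℕ) : 𝕜) * g (n + 2) = x * g (n + 1) - h * g n) :
    powSum N a (fun n => ((n + 1 : ℕ) : 𝕜) * g (n + 1)) =
      x • powSum N a g - h • (a * powSum N a g) := by
  rw [mul_powSum ha g (fun n => if n = 0 then 0 else g (n - 1)) rfl fun n => by simp,
    sub_eq_add_neg, ← neg_smul, ← powSum_comb]
  congr 1
  funext n
  rcases n with _ | n
  · simp [hg1]
  · rw [hg]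
    simp
    ring

lemma powSum_comm (ha : a ^ N = 0) (hg1 : g 1 = x * g 0)
    (hg : ∀ n : ℕ, ((n + 2 : ℕ) : 𝕜) * g (n + 2) = x * g (n + 1) - h * g n)
    (hJ : J * a = a * J + a) :
    J * powSum N a g = powSum N a g * J + a * (x • powSum N a g - h • (a * powSum N a g)) := by
  rw [← powSum_succ ha hg1 hg, mul_powSum ha _ (fun n => (n : 𝕜) * g n) (by simp) fun n => rfl,
    powSum, powSum, Finset.mul_sum, Finset.sum_mul, ← Finset.sum_add_distrib]
  refine Finset.sum_congr rfl fun n _ => ?_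
  rw [mul_smul_comm, comm_pow_of_comm hJ, smul_add, smul_mul_assoc, mul_comm, mul_smul,
    Nat.cast_smul_eq_nsmul]

/-- This is G(a)U = U G(a) + G'(a)K + 4a G''(a), with G' and G'' eliminated through G' = (x - ht)G.
-/
lemma powSum_raise_comm (ha : a ^ N = 0) (hg1 : g 1 = x * g 0)
    (hg : ∀ n : ℕ, ((n + 2 : ℕ) : 𝕜) * g (n + 2) = x * g (n + 1) - h * g n)
    (hU : a * U = U * a + K) (hK : K * a = a * K + 8 • a) :
    powSum N a g * U = U * powSum N a g + (x • powSum N a g - h • (a * powSum N a g)) * K +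
      (4 : 𝕜) • (x • (a * (x • powSum N a g - h • (a * powSum N a g))) -
        h • (a * (a * (x • powSum N a g - h • (a * powSum N a g)) + powSum N a g))) := by
  set D := x • powSum N a g - h • (a * powSum N a g) with hD
  have hD1 : powSum N a (fun n => ((n + 1 : ℕ) : 𝕜) * g (n + 1)) = D := powSum_succ ha hg1 hg
  have haD : a * D = powSum N a (fun n => (n : 𝕜) * g n) := by
    rw [← hD1, mul_powSum ha _ (fun n => (n : 𝕜) * g n) (by simp) fun n => rfl]
  have hE : powSum N a (fun n => ((n : ℕ) : 𝕜) * (((n + 1 : ℕ) : 𝕜) * g (n + 1))) =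
      x • (a * D) - h • (a * (a * D + powSum N a g)) := by
    have h1 : a * D + powSum N a g = powSum N a (fun n => ((n + 1 : ℕ) : 𝕜) * g n) := by
      have := powSum_comb (N := N) (a := a) (fun n => (n : 𝕜) * g n) g 1 1
      rw [haD]
      simp only [one_smul, one_mul] at this
      rw [← this]
      congr 1
      funext n
      push_cast
      ring
    rw [h1, mul_powSum ha _ (fun n => (n : 𝕜) * (if n = 0 then 0 else g (n - 1))) (by simp)
      (fun n => by simp), haD, sub_eq_add_neg, ← neg_smul, ← powSum_comb]
    congr 1
    funext n
    rcases n with _ | n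
    · simp
    · rw [hg]
      simp
      ring
  rw [← hE]
  have h2 : powSum N a g * U - U * powSum N a g =
      ∑ n ∈ Finset.range N, g n • (a ^ n * U - U * a ^ n) := by
    simp only [powSum, Finset.mul_sum, Finset.sum_mul, ← Finset.sum_sub_distrib, smul_sub,
      smul_mul_assoc, mul_smul_comm]
  -- The extra term n = N is zero; it is added so that N terms remain after the n = 0 term is split
  -- off and the index shifted.
  have h3 : ∑ n ∈ Finset.range N, g n • (a ^ n * U - U * a ^ n) =
      ∑ n ∈ Finset.range (N + 1), g n • (a ^ n * U - U * a ^ n) := by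
    rw [Finset.sum_range_succ, ha]
    simp
  rw [h3, Finset.sum_range_succ'] at h2
  simp only [pow_zero, one_mul, mul_one, sub_self, smul_zero, add_zero] at h2
  rw [sub_eq_iff_eq_add'] at h2
  rw [h2, add_assoc]
  congr 1
  rw [← hD1, powSum, powSum, Finset.sum_mul, Finset.smul_sum, ← Finset.sum_add_distrib]
  refine Finset.sum_congr rfl fun n _ => ?_
  rw [pow_comm_of_comm hU hK, smul_mul_assoc]
  simp only [← Nat.cast_smul_eq_nsmul 𝕜]
  push_cast
  module

end Nilpotent

end MVHermite

end

noncomputable section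

namespace MVHermite

open Polynomial MeasureTheory

local notation "Mat" N => Matrix (Fin N) (Fin N) ℂ

/-! ### Diagonal, subdiagonal and superdiagonal matrices -/

/-- The diagonal matrix with entries `f 0, f 1, …`. -/
def dg (N : ℕ) (f : ℕ → ℂ) : Mat N := Matrix.diagonal fun i => f i

/-- The matrix with entries `f j` at the places `(j + 1, j)`. -/
def subDg (N : ℕ) (f : ℕ → ℂ) : Mat N :=
  Matrix.of fun i j => if (i : ℕ) = (j : ℕ) + 1 then f j else 0

/-- The matrix with entries `f i` at the places `(i, i + 1)`. -/
def supDg (N : ℕ) (f : ℕ → ℂ) : Mat N :=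
  Matrix.of fun i j => if (j : ℕ) = (i : ℕ) + 1 then f i else 0

variable {N : ℕ}

lemma dg_congr {f g : ℕ → ℂ} (h : ∀ i < N, f i = g i) : dg N f = dg N g := by
  unfold dg
  congr 1
  funext i
  exact h i i.2

lemma subDg_congr {f g : ℕ → ℂ} (h : ∀ i, i + 1 < N → f i = g i) : subDg N f = subDg N g := by
  ext i j
  simp only [subDg, Matrix.of_apply]
  split_ifs with hij
  · exact h j (hij ▸ i.2)
  · rfl

lemma supDg_congr {f g : ℕ → ℂ} (h : ∀ i, i + 1 < N → f i = g i) : supDg N f = supDg N g := by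
  ext i j
  simp only [supDg, Matrix.of_apply]
  split_ifs with hij
  · exact h i (hij ▸ j.2)
  · rfl

lemma eq_of_supDg_eq {f g : ℕ → ℂ} (h : supDg N f = supDg N g) {i : ℕ} (hi : i + 1 < N) :
    f i = g i := by
  have := congrFun (congrFun h ⟨i, by omega⟩) ⟨i + 1, hi⟩
  simpa [supDg] using this

lemma eq_of_dg_eq {f g : ℕ → ℂ} (h : dg N f = dg N g) {i : ℕ} (hi : i < N) : f i = g i := by
  have := congrFun (congrFun h ⟨i, hi⟩) ⟨i, hi⟩
  simpa [dg] using this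

lemma dg_mul_dg (f g : ℕ → ℂ) : dg N f * dg N g = dg N fun i => f i * g i :=
  Matrix.diagonal_mul_diagonal _ _

lemma dg_mul_subDg (f g : ℕ → ℂ) : dg N f * subDg N g = subDg N fun j => f (j + 1) * g j := by
  ext i j
  simp only [dg, subDg, Matrix.diagonal_mul, Matrix.of_apply]
  split_ifs with h <;> simp [h]

lemma subDg_mul_dg (f g : ℕ → ℂ) : subDg N g * dg N f = subDg N fun j => g j * f j := by
  ext i j
  simp only [dg, subDg, Matrix.mul_diagonal, Matrix.of_apply]
  split_ifs with h <;> simp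

lemma dg_mul_supDg (f g : ℕ → ℂ) : dg N f * supDg N g = supDg N fun j => f j * g j := by
  ext i j
  simp only [dg, supDg, Matrix.diagonal_mul, Matrix.of_apply]
  split_ifs with h <;> simp

lemma supDg_mul_dg (f g : ℕ → ℂ) : supDg N g * dg N f = supDg N fun j => g j * f (j + 1) := by
  ext i j
  simp only [dg, supDg, Matrix.mul_diagonal, Matrix.of_apply]
  split_ifs with h <;> simp [h]

lemma subDg_mul_supDg (f g : ℕ → ℂ) :
    subDg N f * supDg N g = dg N fun i => if i = 0 then 0 else f (i - 1) * g (i - 1) := by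
  ext i k
  simp only [dg, subDg, supDg, Matrix.mul_apply, Matrix.of_apply, Matrix.diagonal_apply]
  by_cases h0 : (i : ℕ) = 0
  · simp [h0]
  · rw [Finset.sum_eq_single (⟨i - 1, by omega⟩ : Fin N)]
    · by_cases hik : i = k
      · subst hik
        simp [h0, Nat.sub_add_cancel (Nat.one_le_iff_ne_zero.2 h0)]
      · have : ¬ (k : ℕ) = i - 1 + 1 := fun h => hik (Fin.ext (by omega))
        simp [hik, this]
    · intro j _ hj
      rw [if_neg, zero_mul]
      exact fun h => hj (Fin.ext (by simp; omega))
    · simp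

lemma supDg_mul_subDg (f g : ℕ → ℂ) :
    supDg N f * subDg N g = dg N fun i => if i + 1 < N then f i * g i else 0 := by
  ext i k
  simp only [dg, subDg, supDg, Matrix.mul_apply, Matrix.of_apply, Matrix.diagonal_apply]
  by_cases h0 : (i : ℕ) + 1 < N
  · rw [Finset.sum_eq_single (⟨i + 1, h0⟩ : Fin N)]
    · by_cases hik : i = k
      · subst hik
        simp [h0]
      · have : ¬ (i : ℕ) = k := fun h => hik (Fin.ext h)
        simp [hik, this]
    · intro j _ hj
      rw [if_neg, zero_mul]
      exact fun h => hj (Fin.ext h)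
    · simp
  · rw [Finset.sum_eq_zero]
    · simp [h0]
    · intro j _
      rw [if_neg, zero_mul]
      have := j.2
      omega

lemma dg_add (f g : ℕ → ℂ) : dg N f + dg N g = dg N fun i => f i + g i :=
  Matrix.diagonal_add _ _

lemma dg_sub (f g : ℕ → ℂ) : dg N f - dg N g = dg N fun i => f i - g i :=
  Matrix.diagonal_sub _ _

lemma smul_dg (c : ℂ) (f : ℕ → ℂ) : c • dg N f = dg N fun i => c * f i :=
  (Matrix.diagonal_smul _ _).symm

lemma subDg_add (f g : ℕ → ℂ) : subDg N f + subDg N g = subDg N fun i => f i + g i := by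
  ext i j
  simp only [subDg, Matrix.add_apply, Matrix.of_apply]
  split_ifs <;> simp

lemma smul_subDg (c : ℂ) (f : ℕ → ℂ) : c • subDg N f = subDg N fun i => c * f i := by
  ext i j
  simp [subDg]

lemma supDg_add (f g : ℕ → ℂ) : supDg N f + supDg N g = supDg N fun i => f i + g i := by
  ext i j
  simp only [supDg, Matrix.add_apply, Matrix.of_apply]
  split_ifs <;> simp

lemma smul_supDg (c : ℂ) (f : ℕ → ℂ) : c • supDg N f = supDg N fun i => c * f i := by
  ext i j
  simp [supDg]

lemma dg_one : dg N (fun _ => 1) = 1 := Matrix.diagonal_one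

lemma dg_mul_dg_inv {f : ℕ → ℂ} (h : ∀ i < N, f i ≠ 0) : dg N f * dg N (fun i => (f i)⁻¹) = 1 := by
  rw [dg_mul_dg, ← dg_one]
  exact dg_congr fun i hi => mul_inv_cancel₀ (h i hi)

lemma dg_inv {f : ℕ → ℂ} (h : ∀ i < N, f i ≠ 0) : (dg N f)⁻¹ = dg N fun i => (f i)⁻¹ :=
  Matrix.inv_eq_right_inv (dg_mul_dg_inv h)

lemma isUnit_dg {f : ℕ → ℂ} (h : ∀ i < N, f i ≠ 0) : IsUnit (dg N f) :=
  IsUnit.of_mul_eq_one _ (dg_mul_dg_inv h)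

lemma star_dg (f : ℕ → ℂ) : star (dg N f) = dg N fun i => star (f i) := by
  simp only [dg, Matrix.star_eq_conjTranspose, Matrix.diagonal_conjTranspose]
  rfl

lemma star_subDg (f : ℕ → ℂ) : star (subDg N f) = supDg N fun i => star (f i) := by
  ext i j
  simp only [subDg, supDg, Matrix.star_apply, Matrix.of_apply]
  split_ifs <;> simp

/-! ### The matrices of the problem -/

variable {α : ℕ → ℝ}

lemma matJ_eq : matJ N = dg N fun i => (i : ℂ) + 1 := rfl

lemma matA_eq : matA N = subDg N fun _ => 2 := rfl

lemma matS_eq : matS N α = dg N fun i => (α (i + 1) : ℂ) := rfl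

lemma matDelta_eq (δ : ℕ → ℝ) : matDelta N δ = dg N fun i => (δ (i + 1) : ℂ) := rfl

lemma shiftJ_eq (r : ℝ) : shiftJ N r = dg N fun i => (N : ℂ) + r - i := by
  rw [shiftJ, matJ_eq, ← dg_one, smul_dg, dg_sub]
  exact dg_congr fun i _ => by ring

lemma matS_inv (hα : ∀ i < N, α (i + 1) ≠ 0) :
    (matS N α)⁻¹ = dg N fun i => (α (i + 1) : ℂ)⁻¹ :=
  dg_inv fun i hi => Complex.ofReal_ne_zero.2 (hα i hi)

lemma matAα_eq (hα : ∀ i < N, α (i + 1) ≠ 0) :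
    matAα N α = subDg N fun j => 2 * (α (j + 2) / α (j + 1) : ℂ) := by
  rw [matAα, matS_inv hα, matS_eq, matA_eq, dg_mul_subDg, subDg_mul_dg]
  exact subDg_congr fun i _ => by ring

lemma matU_eq (hα : ∀ i < N, α (i + 1) ≠ 0) :
    matU N α = supDg N fun i => 2 * ((i + 1) * (N - (i + 1)) * (α (i + 1) / α (i + 2))) := by
  rw [matU, matS_inv hα, matS_eq, matA_eq, ← Matrix.star_eq_conjTranspose, star_subDg,
    dg_mul_supDg, supDg_mul_dg, matJ_eq, ← dg_one, smul_dg, dg_sub, dg_mul_dg, dg_mul_supDg]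
  refine supDg_congr fun i _ => ?_
  rw [show star (2 : ℂ) = 2 from Complex.conj_ofNat 2]
  ring

lemma star_matAα (hα : ∀ i < N, α (i + 1) ≠ 0) :
    star (matAα N α) = supDg N fun j => 2 * (α (j + 2) / α (j + 1) : ℂ) := by
  rw [matAα_eq hα, star_subDg]
  refine supDg_congr fun i _ => ?_
  have : (2 * (α (i + 2) / α (i + 1)) : ℂ) = ((2 * (α (i + 2) / α (i + 1)) : ℝ) : ℂ) := by
    push_cast; rfl
  rw [this]
  exact Complex.conj_ofReal _

lemma matJ_mul_matAα (hα : ∀ i < N, α (i + 1) ≠ 0) :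
    matJ N * matAα N α = matAα N α * matJ N + matAα N α := by
  rw [matAα_eq hα, matJ_eq, dg_mul_subDg, subDg_mul_dg, subDg_add]
  exact subDg_congr fun i _ => by push_cast; ring

/-- The commutator of `A^α` and `matU`. -/
def matK (N : ℕ) : Mat N := (8 : ℂ) • matJ N - (4 * (N + 1) : ℂ) • 1

/-- The α-ratios cancel, and the diagonal entries of the commutator are differences of 4f at
consecutive integers, f(i) = i(N - i). Being differences of a quadratic they are linear in i, and
f(0) = f(N) = 0 makes both ends fit. -/
lemma matAα_mul_matU (hα : ∀ i < N, α (i + 1) ≠ 0) :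
    matAα N α * matU N α = matU N α * matAα N α + matK N := by
  rw [matAα_eq hα, matU_eq hα, subDg_mul_supDg, supDg_mul_subDg, matK, matJ_eq, ← dg_one, smul_dg,
    smul_dg, dg_sub, dg_add]
  have key : ∀ i, i + 1 < N → 2 * (α (i + 2) / α (i + 1) : ℂ) *
      (2 * ((i + 1) * (N - (i + 1)) * (α (i + 1) / α (i + 2)))) = 4 * ((i + 1) * (N - (i + 1))) := by
    intro i hi
    have h1 : (α (i + 1) : ℂ) ≠ 0 := Complex.ofReal_ne_zero.2 (hα i (by omega))
    have h2 : (α (i + 2) : ℂ) ≠ 0 := Complex.ofReal_ne_zero.2 (hα (i + 1) hi)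
    field_simp
    ring
  refine dg_congr fun i hi => ?_
  have e1 : (if i = 0 then (0 : ℂ) else 2 * (α (i - 1 + 2) / α (i - 1 + 1) : ℂ) *
      (2 * (((i - 1 : ℕ) + 1) * (N - ((i - 1 : ℕ) + 1)) * (α (i - 1 + 1) / α (i - 1 + 2))))) =
      4 * (i * (N - i)) := by
    rcases i with _ | i
    · simp
    · rw [if_neg (by omega), Nat.add_sub_cancel, key i hi]
      push_cast
      ring
  have e2 : (if i + 1 < N then 2 * ((i + 1) * (N - (i + 1)) * (α (i + 1) / α (i + 2))) *
      (2 * (α (i + 2) / α (i + 1) : ℂ)) else 0) = 4 * ((i + 1) * (N - (i + 1))) := by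
    split_ifs with h
    · rw [mul_comm, key i h]
    · have : N = i + 1 := by omega
      rw [this]
      push_cast
      ring
  rw [e1, e2]
  ring

lemma matK_mul_matAα (hα : ∀ i < N, α (i + 1) ≠ 0) :
    matK N * matAα N α = matAα N α * matK N + 8 • matAα N α := by
  rw [matK, sub_mul, mul_sub, smul_mul_assoc, smul_mul_assoc, mul_smul_comm, mul_smul_comm,
    matJ_mul_matAα hα, mul_one, one_mul]
  module

lemma matA_pow_apply (n : ℕ) (i j : Fin N) :
    (matA N ^ n) i j = if (i : ℕ) = (j : ℕ) + n then 2 ^ n else 0 := by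
  induction n generalizing j with
  | zero => simp [Matrix.one_apply, Fin.ext_iff]
  | succ n ih =>
    rw [pow_succ, Matrix.mul_apply]
    have hA : ∀ i j : Fin N, matA N i j = if (i : ℕ) = (j : ℕ) + 1 then 2 else 0 := fun _ _ => rfl
    simp only [ih, hA, ite_mul, mul_ite, zero_mul, mul_zero]
    by_cases h : (j : ℕ) + 1 < N
    · rw [Finset.sum_eq_single (⟨j + 1, h⟩ : Fin N)]
      · simp only [if_true]
        by_cases h2 : (i : ℕ) = j + 1 + n
        · rw [if_pos h2, if_pos (by omega), pow_succ]
        · rw [if_neg h2, if_neg (by omega)]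
      · intro k _ hk
        rw [if_neg fun h' => hk (Fin.ext h')]
      · simp
    · rw [if_neg (by have := i.2; omega)]
      refine Finset.sum_eq_zero fun k _ => ?_
      rw [if_neg (by have := k.2; omega)]

lemma matAα_pow (hα : ∀ i < N, α (i + 1) ≠ 0) (n : ℕ) :
    matAα N α ^ n = matS N α * matA N ^ n * (matS N α)⁻¹ := by
  have hS : (matS N α)⁻¹ * matS N α = 1 :=
    Matrix.nonsing_inv_mul _ ((Matrix.isUnit_iff_isUnit_det _).1
      (isUnit_dg fun i hi => Complex.ofReal_ne_zero.2 (hα i hi)))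
  have hS' : matS N α * (matS N α)⁻¹ = 1 := mul_eq_one_comm.1 hS
  induction n with
  | zero => simp [hS']
  | succ n ih =>
    rw [pow_succ, ih, matAα, pow_succ]
    simp only [mul_assoc]
    rw [← mul_assoc _ (matS N α), hS, one_mul]

lemma matAα_pow_eq_zero (hα : ∀ i < N, α (i + 1) ≠ 0) : matAα N α ^ N = 0 := by
  have : matA N ^ N = 0 := by
    ext i j
    rw [matA_pow_apply, if_neg (by omega)]
    rfl
  rw [matAα_pow hα, this, mul_zero, zero_mul]

/-! ### The weight polynomial -/

attribute [local instance] Polynomial.algebra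

/-- `Hₙ / (n! 2ⁿ)` with complex coefficients. -/
def cHermite (n : ℕ) : ℂ[X] := (scaledHermite n).map (algebraMap ℝ ℂ)

lemma cHermite_one : cHermite 1 = X * cHermite 0 := by
  simp [cHermite, scaledHermite_zero, scaledHermite_one]

lemma cHermite_rec (n : ℕ) : ((n + 2 : ℕ) : ℂ[X]) * cHermite (n + 2) =
    X * cHermite (n + 1) - C (1 / 2 : ℂ) * cHermite n := by
  have h := congrArg (Polynomial.map (algebraMap ℝ ℂ)) (scaledHermite_rec n)
  simpa [cHermite] using h

/-- The polynomial `L^α` with matrix coefficients. -/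
def polyL (N : ℕ) (α : ℕ → ℝ) : Polynomial (Mat N) := powSum N (C (matAα N α)) cHermite

/-- The polynomial `L^α Δ (L^α)^*` with matrix coefficients. -/
def polyM (N : ℕ) (α δ : ℕ → ℝ) : Polynomial (Mat N) :=
  polyL N α * C (matDelta N δ) * adj (polyL N α)

/-- Over ℂ[X], both x and the scalar constants act centrally, so identities of matrix polynomials
can be settled by `module` and `match_scalars`. -/
lemma smul_eq_map_mul (g : ℂ[X]) (F : Polynomial (Mat N)) :
    g • F = g.map (algebraMap ℂ (Mat N)) * F :=
  Algebra.smul_def g F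

lemma X_smul_eq (F : Polynomial (Mat N)) : (X : ℂ[X]) • F = X * F := by
  rw [smul_eq_map_mul, map_X]

lemma C_smul_eq (c : ℂ) (F : Polynomial (Mat N)) : (C c : ℂ[X]) • F = c • F := by
  rw [smul_eq_map_mul, map_C, ← smul_eq_C_mul, algebraMap_smul]

lemma evalReal_smul (g : ℝ[X]) (F : Polynomial (Mat N)) (x : ℝ) :
    evalReal ((g.map (algebraMap ℝ ℂ)) • F) x = ((g.eval x : ℝ) : ℂ) • evalReal F x := by
  rw [smul_eq_map_mul, evalReal_mul]
  have h : evalReal ((g.map (algebraMap ℝ ℂ)).map (algebraMap ℂ (Mat N))) x =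
      ((g.eval x : ℝ) : ℂ) • (1 : Mat N) := by
    induction g using Polynomial.induction_on' with
    | add p q hp hq =>
      simp only [Polynomial.map_add, evalReal_add, hp, hq, eval_add, Complex.ofReal_add, add_smul]
    | monomial k b =>
      rw [map_monomial, map_monomial, evalReal_monomial, Algebra.algebraMap_eq_smul_one, smul_smul,
        eval_monomial]
      congr 1
      simp [mul_comm]
  rw [h, smul_mul_assoc, one_mul]

lemma evalReal_sum {ι : Type*} (s : Finset ι) (F : ι → Polynomial (Mat N)) (x : ℝ) :
    evalReal (∑ i ∈ s, F i) x = ∑ i ∈ s, evalReal (F i) x :=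
  eval_finsetSum _ _ _

lemma evalReal_polyL (hα : ∀ i < N, α (i + 1) ≠ 0) (x : ℝ) :
    evalReal (polyL N α) x = matLα N α x := by
  -- A^n has the entry 2^n along its n-th subdiagonal, which explains the factor 2^n in
  -- `scaledHermite`.
  have h : matL N x = ∑ n ∈ Finset.range N, (((scaledHermite n).eval x : ℝ) : ℂ) • matA N ^ n := by
    ext i j
    rw [Matrix.sum_apply]
    simp only [Matrix.smul_apply, matA_pow_apply, matL, Matrix.of_apply, smul_eq_mul, mul_ite,
      mul_zero]
    split_ifs with hij
    · have hij' : (j : ℕ) ≤ i := hij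
      rw [Finset.sum_eq_single ((i : ℕ) - j)]
      · rw [if_pos (by omega), scaledHermite, eval_C_mul]
        have h1 : (((i : ℕ) - (j : ℕ)).factorial : ℂ) ≠ 0 :=
          Nat.cast_ne_zero.2 (Nat.factorial_ne_zero _)
        push_cast
        field_simp
      · intro n _ hn
        rw [if_neg (by omega)]
      · intro hn
        exact absurd (Finset.mem_range.2 (by omega)) hn
    · have hij' : (i : ℕ) < j := not_le.1 hij
      rw [Finset.sum_eq_zero fun n _ => if_neg (by omega)]
  rw [matLα, h, polyL, powSum, evalReal_sum, Finset.mul_sum, Finset.sum_mul]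
  refine Finset.sum_congr rfl fun n _ => ?_
  rw [cHermite, evalReal_smul, ← C_pow, evalReal_C, matAα_pow hα, mul_smul_comm, smul_mul_assoc]

lemma weight_eq (hα : ∀ i < N, α (i + 1) ≠ 0) (δ : ℕ → ℝ) (x : ℝ) :
    weight N α δ x = (Real.exp (-x ^ 2) : ℂ) • evalReal (polyM N α δ) x := by
  rw [weight, polyM, evalReal_mul, evalReal_mul, evalReal_C, evalReal_adj, evalReal_polyL hα,
    mul_smul_comm, smul_mul_assoc]

lemma star_matDelta (δ : ℕ → ℝ) : star (matDelta N δ) = matDelta N δ := by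
  rw [matDelta_eq, star_dg]
  exact dg_congr fun i _ => Complex.conj_ofReal _

lemma adj_polyM (δ : ℕ → ℝ) : adj (polyM N α δ) = polyM N α δ := by
  rw [polyM, adj_mul, adj_mul, adj_adj, adj_C, star_matDelta, mul_assoc]

end MVHermite

end

/-! ### Derivative of L^α and conjugation of J and U by it -/

noncomputable section

namespace MVHermite

open Polynomial MeasureTheory

local notation "Mat" N => Matrix (Fin N) (Fin N) ℂ

variable {N : ℕ} {α : ℕ → ℝ}

attribute [local instance] Polynomial.algebra

lemma derivative_smul_map (g : ℂ[X]) (F : Polynomial (Mat N)) :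
    derivative (g • F) = derivative g • F + g • derivative F := by
  rw [smul_eq_map_mul, derivative_mul, derivative_map, ← smul_eq_map_mul, ← smul_eq_map_mul]

lemma derivative_cHermite (n : ℕ) : derivative (cHermite (n + 1)) = cHermite n := by
  rw [cHermite, derivative_map, derivative_scaledHermite, cHermite]

lemma derivative_polyL (hα : ∀ i < N, α (i + 1) ≠ 0) :
    derivative (polyL N α) = C (matAα N α) * polyL N α := by
  have ha : (C (matAα N α) : Polynomial (Mat N)) ^ N = 0 := by
    rw [← C_pow, matAα_pow_eq_zero hα, C_0]
  rw [polyL, mul_powSum ha _ (fun n => derivative (cHermite n))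
    (by simp [cHermite, scaledHermite_zero]) derivative_cHermite, powSum, powSum,
    derivative_sum]
  refine Finset.sum_congr rfl fun n _ => ?_
  rw [derivative_smul_map, ← C_pow, derivative_C, smul_zero, add_zero]

/-- Conjugation of `J` by `L^α`. -/
lemma polyL_mul_matJ (hα : ∀ i < N, α (i + 1) ≠ 0) :
    polyL N α * C (matJ N) = C (matJ N) * polyL N α -
      (X : ℂ[X]) • (C (matAα N α) * polyL N α) +
      (C (1 / 2) : ℂ[X]) • (C (matAα N α) * (C (matAα N α) * polyL N α)) := by
  have ha : (C (matAα N α) : Polynomial (Mat N)) ^ N = 0 := by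
    rw [← C_pow, matAα_pow_eq_zero hα, C_0]
  have hJ : (C (matJ N) : Polynomial (Mat N)) * C (matAα N α) =
      C (matAα N α) * C (matJ N) + C (matAα N α) := by
    rw [← C_mul, ← C_mul, ← C_add, matJ_mul_matAα hα]
  have h := powSum_comm ha cHermite_one cHermite_rec hJ
  simp only [mul_sub, mul_smul_comm] at h
  rw [polyL, h]
  abel

/-- Conjugation of `matU` by `L^α`. -/
lemma polyL_mul_matU (hα : ∀ i < N, α (i + 1) ≠ 0) :
    polyL N α * C (matU N α) = C (matU N α) * polyL N α +
      (X : ℂ[X]) • (C (matK N) * polyL N α) -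
      (C (1 / 2) : ℂ[X]) • (C (matAα N α) * (C (matK N) * polyL N α)) -
      (2 : ℂ[X]) • (C (matAα N α) * polyL N α) -
      (4 * X ^ 2 : ℂ[X]) • (C (matAα N α) * polyL N α) +
      (4 * X : ℂ[X]) • (C (matAα N α) * (C (matAα N α) * polyL N α)) -
      C (matAα N α) * (C (matAα N α) * (C (matAα N α) * polyL N α)) := by
  have ha : (C (matAα N α) : Polynomial (Mat N)) ^ N = 0 := by
    rw [← C_pow, matAα_pow_eq_zero hα, C_0]
  have hU : (C (matAα N α) : Polynomial (Mat N)) * C (matU N α) =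
      C (matU N α) * C (matAα N α) + C (matK N) := by
    rw [← C_mul, ← C_mul, ← C_add, matAα_mul_matU hα]
  have hK : (C (matK N) : Polynomial (Mat N)) * C (matAα N α) =
      C (matAα N α) * C (matK N) + 8 • C (matAα N α) := by
    rw [← C_mul, ← C_mul, matK_mul_matAα hα, C_add]
    simp
  -- K is an affine function of J, so its conjugation follows from that of J.
  have hLK : polyL N α * C (matK N) = C (matK N) * polyL N α -
      (8 * X : ℂ[X]) • (C (matAα N α) * polyL N α) +
      (4 : ℂ[X]) • (C (matAα N α) * (C (matAα N α) * polyL N α)) := by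
    have e : (C (matK N) : Polynomial (Mat N)) =
        (8 : ℂ[X]) • C (matJ N) - (C (4 * (N + 1)) : ℂ[X]) • 1 := by
      rw [matK, C_sub, C_smul_eq, show (8 : ℂ[X]) = C 8 from rfl, C_smul_eq, smul_C, ← C_1, smul_C]
    rw [e, mul_sub, sub_mul, mul_smul_comm, mul_smul_comm, smul_mul_assoc, smul_mul_assoc,
      polyL_mul_matJ hα, mul_one, one_mul]
    have h8 : (8 : ℂ[X]) * C (1 / 2) = 4 := by
      rw [show (8 : ℂ[X]) = C 8 from rfl, ← C_mul]
      norm_num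
      rfl
    have h8' (v : Polynomial (Mat N)) : (4 : ℂ[X]) • v = (8 : ℂ[X]) • (C (1 / 2) : ℂ[X]) • v := by
      rw [smul_smul, h8]
    rw [h8']
    module
  have h := powSum_raise_comm ha cHermite_one cHermite_rec hU hK
  have h2 : (2 : ℂ[X]) * C (1 / 2) = 1 := by
    rw [show (2 : ℂ[X]) = C 2 from rfl, ← C_mul]
    norm_num
  change polyL N α * C (matU N α) = C (matU N α) * polyL N α +
    ((X : ℂ[X]) • polyL N α - (C (1 / 2) : ℂ[X]) • (C (matAα N α) * polyL N α)) * C (matK N) + _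
    at h
  rw [sub_mul, smul_mul_assoc, smul_mul_assoc, mul_assoc, hLK] at h
  rw [h]
  clear h hLK ha
  change _ + (4 : ℂ[X]) • ((X : ℂ[X]) • (_ * ((X : ℂ[X]) • polyL N α -
    (C (1 / 2) : ℂ[X]) • (C (matAα N α) * polyL N α))) - (C (1 / 2) : ℂ[X]) • (_ * (_ * ((X : ℂ[X])
      • polyL N α - (C (1 / 2) : ℂ[X]) • (C (matAα N α) * polyL N α)) + polyL N α))) = _
  simp only [mul_sub, mul_add, mul_smul_comm]
  generalize (C (1 / 2) : ℂ[X]) = h at h2 ⊢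
  match_scalars <;> grind

end MVHermite

end

/-! ### The Pearson equations between consecutive weights -/

noncomputable section

namespace MVHermite

open Polynomial MeasureTheory

local notation "Mat" N => Matrix (Fin N) (Fin N) ℂ

variable {N : ℕ} {α δ δ' : ℕ → ℝ} {c d : ℝ}

attribute [local instance] Polynomial.algebra

lemma derivative_polyM (hα : ∀ i < N, α (i + 1) ≠ 0) (δ : ℕ → ℝ) :
    derivative (polyM N α δ) =
      C (matAα N α) * polyM N α δ + polyM N α δ * C (star (matAα N α)) := by
  have h : derivative (adj (polyL N α)) = adj (polyL N α) * C (star (matAα N α)) := by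
    rw [← adj_derivative, derivative_polyL hα, adj_mul, adj_C]
  rw [polyM, derivative_mul, derivative_mul, derivative_polyL hα, derivative_C, h]
  simp only [mul_assoc, mul_zero, add_zero]

lemma adj_polyL_mul :
    adj (polyL N α) * C (star (matAα N α)) = C (star (matAα N α)) * adj (polyL N α) := by
  have h : C (matAα N α) * polyL N α = polyL N α * C (matAα N α) := by
    rw [polyL, powSum, Finset.mul_sum, Finset.sum_mul]
    refine Finset.sum_congr rfl fun n _ => ?_
    rw [mul_smul_comm, smul_mul_assoc, ← pow_succ, ← pow_succ']
  have := congrArg adj h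
  rwa [adj_mul, adj_mul, adj_C] at this

/-- The coefficients of the linear polynomial `Φ` with `W^{(ν+1)} = Φ W^{(ν)}`. -/
def phi0 (N : ℕ) (α : ℕ → ℝ) (c d : ℝ) : Mat N :=
  (d : ℂ) • matJ N + (c : ℂ) • 1 + (d / 2 : ℂ) • (matAα N α * matAα N α)

/-- The matrix `Ψ₀ / d`. -/
def psi0 (N : ℕ) (α : ℕ → ℝ) (r : ℝ) : Mat N :=
  shiftJ N r * matAα N α + (1 / 2 : ℂ) • matU N α

/-- The new diagonal factor is (dJ + c)Δ, and Φ is dJ + c conjugated by L^α. -/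
lemma polyM_shift (hα : ∀ i < N, α (i + 1) ≠ 0)
    (hδ : ∀ i < N, δ' (i + 1) = (d * (i + 1) + c) * δ (i + 1)) :
    polyM N α δ' = (C (phi0 N α c d) + C (-(d : ℂ) • matAα N α) * X) * polyM N α δ := by
  have hD : (C (matDelta N δ') : Polynomial (Mat N)) =
      (C (d : ℂ) : ℂ[X]) • (C (matJ N) * C (matDelta N δ)) +
        (C (c : ℂ) : ℂ[X]) • C (matDelta N δ) := by
    rw [← C_mul, C_smul_eq, C_smul_eq, smul_C, smul_C, ← C_add]
    congr 1
    rw [matDelta_eq, matDelta_eq, matJ_eq, dg_mul_dg, smul_dg, smul_dg, dg_add]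
    refine dg_congr fun i hi => ?_
    rw [hδ i hi]
    push_cast
    ring
  have e0 : (C (phi0 N α c d) : Polynomial (Mat N)) = (C (d : ℂ) : ℂ[X]) • C (matJ N) +
      (C (c : ℂ) : ℂ[X]) • 1 +
      (C (d : ℂ) * C (1 / 2) : ℂ[X]) • (C (matAα N α) * C (matAα N α)) := by
    rw [← C_mul, ← C_mul, C_smul_eq, C_smul_eq, C_smul_eq, phi0, C_add, C_add, smul_C, smul_C,
      ← C_1, smul_C, div_eq_mul_one_div]
  have e1 : (C (-(d : ℂ) • matAα N α) * X : Polynomial (Mat N)) =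
      (X : ℂ[X]) • (-(C (d : ℂ) : ℂ[X]) • C (matAα N α)) := by
    rw [X_smul_eq, X_mul, ← C_neg, C_smul_eq, smul_C]
  rw [e0, e1, polyM, hD, polyM, mul_add, mul_smul_comm, ← mul_assoc, polyL_mul_matJ hα]
  simp only [add_mul, sub_mul, smul_mul_assoc, mul_smul_comm, mul_assoc, one_mul]
  module

/-- Differentiation gives A M' + M' A^* for the shifted M'. By `hrec`, Δ'A^* = (d/2) U Δ, so A^* is
traded for U on the left of Δ, and conjugation by L^α brings it to the front. The x² and A³ terms
then cancel, which leaves a factor of degree one in x. -/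
lemma polyM_pearson (hα : ∀ i < N, α (i + 1) ≠ 0) (hd : d ≠ 0) {r : ℝ} (hr : r = c / d)
    (hδ : ∀ i < N, δ' (i + 1) = (d * (i + 1) + c) * δ (i + 1))
    (hrec : ∀ i, i + 1 < N → δ' (i + 1) * (α (i + 2) / α (i + 1)) =
      d / 2 * ((i + 1) * (N - (i + 1)) * (α (i + 1) / α (i + 2))) * δ (i + 2)) :
    derivative (polyM N α δ') - (2 : ℂ) • (X * polyM N α δ') =
      (C ((d : ℂ) • psi0 N α r) + C (-(2 * d : ℂ) • shiftJ N r) * X) * polyM N α δ := by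
  have hDA : (C (matDelta N δ') * C (star (matAα N α)) : Polynomial (Mat N)) =
      (C (d : ℂ) * C (1 / 2) : ℂ[X]) • (C (matU N α) * C (matDelta N δ)) := by
    rw [← C_mul, ← C_mul, ← C_mul, C_smul_eq, smul_C]
    congr 1
    rw [matDelta_eq, matDelta_eq, star_matAα hα, matU_eq hα, dg_mul_supDg, supDg_mul_dg, smul_supDg]
    refine supDg_congr fun i hi => ?_
    have h := congrArg (fun x : ℝ => (x : ℂ)) (hrec i hi)
    push_cast at h
    linear_combination 2 * h
  have h2 : (2 : ℂ[X]) * C (1 / 2) = 1 := by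
    rw [show (2 : ℂ[X]) = C 2 from rfl, ← C_mul]
    norm_num
  have eG : (C (shiftJ N r) : Polynomial (Mat N)) =
      ((N : ℂ[X]) + 1 + C (r : ℂ)) • (1 : Polynomial (Mat N)) - C (matJ N) := by
    rw [shiftJ, C_sub, ← smul_C, ← C_smul_eq, C_add, C_add, C_1, C_1, C_eq_natCast]
  have eK : (C (matK N) : Polynomial (Mat N)) =
      (8 : ℂ[X]) • C (matJ N) - (4 * ((N : ℂ[X]) + 1)) • 1 := by
    have h4 : (4 * ((N : ℂ[X]) + 1)) = C (4 * ((N : ℂ) + 1)) := by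
      rw [C_mul, C_add, C_1, C_eq_natCast]
      rfl
    rw [h4, matK, C_sub, C_smul_eq, show (8 : ℂ[X]) = C 8 from rfl, C_smul_eq, smul_C, ← C_1,
      smul_C]
  have e0 : (C ((d : ℂ) • psi0 N α r) : Polynomial (Mat N)) =
      (C (d : ℂ) : ℂ[X]) • (C (shiftJ N r) * C (matAα N α)) +
        (C (d : ℂ) * C (1 / 2) : ℂ[X]) • C (matU N α) := by
    rw [← C_mul, ← C_mul, C_smul_eq, C_smul_eq, psi0, smul_add, smul_smul, C_add, smul_C, smul_C]
  have e1 : (C (-(2 * d : ℂ) • shiftJ N r) * X : Polynomial (Mat N)) =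
      (-(2 * C (d : ℂ)) * X : ℂ[X]) • C (shiftJ N r) := by
    rw [mul_comm _ (X : ℂ[X]), mul_smul, X_smul_eq, X_mul, show (2 : ℂ[X]) = C 2 from rfl, ← C_mul,
      ← C_neg, C_smul_eq, smul_C]
  have e2 : (C (phi0 N α c d) : Polynomial (Mat N)) = (C (d : ℂ) : ℂ[X]) • C (matJ N) +
      (C (d : ℂ) * C (r : ℂ) : ℂ[X]) • 1 +
      (C (d : ℂ) * C (1 / 2) : ℂ[X]) • (C (matAα N α) * C (matAα N α)) := by
    have hc : (c : ℂ) = d * r := by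
      rw [hr]
      push_cast
      field_simp [Complex.ofReal_ne_zero.2 hd]
    rw [← C_mul, ← C_mul, ← C_mul, C_smul_eq, C_smul_eq, C_smul_eq, phi0, C_add, C_add, smul_C,
      smul_C, ← C_1, smul_C, div_eq_mul_one_div, hc]
  have e3 : (C (-(d : ℂ) • matAα N α) * X : Polynomial (Mat N)) =
      (X : ℂ[X]) • (-(C (d : ℂ) : ℂ[X]) • C (matAα N α)) := by
    rw [X_smul_eq, X_mul, ← C_neg, C_smul_eq, smul_C]
  have hJA : (C (matJ N) : Polynomial (Mat N)) * C (matAα N α) =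
      C (matAα N α) * C (matJ N) + C (matAα N α) := by
    rw [← C_mul, ← C_mul, ← C_add, matJ_mul_matAα hα]
  have hMA : polyM N α δ' * C (star (matAα N α)) = (C (d : ℂ) * C (1 / 2) : ℂ[X]) •
      (polyL N α * C (matU N α) * (C (matDelta N δ) * adj (polyL N α))) := by
    rw [polyM, mul_assoc, adj_polyL_mul, mul_assoc, ← mul_assoc (C _) (C _), hDA, smul_mul_assoc,
      mul_smul_comm]
    simp only [mul_assoc]
  have hMX : (2 : ℂ) • (X * polyM N α δ') = (2 * X : ℂ[X]) • polyM N α δ' := by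
    rw [mul_smul, X_smul_eq, show (2 : ℂ[X]) = C 2 from rfl, C_smul_eq]
  have hm : polyL N α * (C (matDelta N δ) * adj (polyL N α)) = polyM N α δ := by
    rw [polyM, mul_assoc]
  rw [polyL_mul_matU hα] at hMA
  simp only [eK, mul_add, add_mul, sub_mul, smul_mul_assoc, mul_assoc, one_mul, mul_one, hm] at hMA
  rw [derivative_polyM hα, hMA, hMX, polyM_shift hα hδ, e0, e1, e2, e3, eG]
  simp only [mul_add, add_mul, sub_mul, mul_sub, smul_mul_assoc, mul_smul_comm, mul_assoc,
    one_mul]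
  rw [← mul_assoc (C (matJ N)) (C (matAα N α)), hJA, add_mul, mul_assoc]
  clear hMA hMX hJA e0 e1 e2 e3 eG eK hDA hm hα hδ hrec hr
  -- The relation 2h = 1 is all that the scalar identities need about the constant 1/2.
  generalize (C (1 / 2) : ℂ[X]) = h at h2 ⊢
  match_scalars <;> grind

end MVHermite

end

noncomputable section

namespace MVHermite

open Polynomial MeasureTheory

local notation "Mat" N => Matrix (Fin N) (Fin N) ℂ

variable {N : ℕ}

attribute [local instance] Polynomial.algebra

/-! ### The raising operator -/

/-- The raising operator `Q ↦ Q' Φ + Q Ψ` for linear `Φ` and `Ψ`. -/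
def raise (φ₀ φ₁ ψ₀ ψ₁ : Mat N) (Q : Polynomial (Mat N)) : Polynomial (Mat N) :=
  derivative Q * (C φ₀ + C φ₁ * X) + Q * (C ψ₀ + C ψ₁ * X)

/-- By the Pearson equations, e^{-x²} times the raised Q times M is the derivative of e^{-x²} Q M',
so this is integration by parts. At k = 0 the factor k makes the truncated exponent harmless. -/
lemma gaussInt_raise {φ₀ φ₁ ψ₀ ψ₁ : Mat N} {M M' : Polynomial (Mat N)}
    (h1 : M' = (C φ₀ + C φ₁ * X) * M)
    (h2 : derivative M' - (2 : ℂ) • (X * M') = (C ψ₀ + C ψ₁ * X) * M)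
    (Q : Polynomial (Mat N)) (k : ℕ) :
    gaussInt (raise φ₀ φ₁ ψ₀ ψ₁ Q * M * X ^ k) = -(k : ℂ) • gaussInt (Q * M' * X ^ (k - 1)) := by
  have h3 : raise φ₀ φ₁ ψ₀ ψ₁ Q * M * X ^ k = derivative (Q * M' * X ^ k) -
      (k : ℂ) • (Q * M' * X ^ (k - 1)) - (2 : ℂ) • (X * (Q * M' * X ^ k)) := by
    have h4 : (k : ℂ) • (Q * M' * X ^ (k - 1)) = Q * M' * derivative (X ^ k) := by
      rw [derivative_X_pow, C_eq_natCast, ← nsmul_eq_mul, mul_smul_comm, Nat.cast_smul_eq_nsmul]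
    have h5 : X * (Q * M' * X ^ k) = Q * (X * M') * X ^ k := by
      rw [X_mul, X_mul, mul_assoc, mul_assoc, mul_assoc, mul_assoc, ← pow_succ, ← pow_succ']
    rw [raise, add_mul, mul_assoc (derivative Q), ← h1, mul_assoc Q, ← h2, derivative_mul,
      derivative_mul, h4, h5, mul_sub, mul_smul_comm, add_mul, add_mul, sub_mul, smul_mul_assoc]
    abel
  rw [h3, map_sub, map_sub, gaussInt_derivative, map_smul, map_smul]
  module

lemma coeff_raise_succ {φ₀ φ₁ ψ₀ ψ₁ : Mat N} (Q : Polynomial (Mat N)) (m : ℕ) :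
    (raise φ₀ φ₁ ψ₀ ψ₁ Q).coeff (m + 1) =
      (m + 2 : ℂ) • (Q.coeff (m + 2) * φ₀) + (m + 1 : ℂ) • (Q.coeff (m + 1) * φ₁) +
        (Q.coeff (m + 1) * ψ₀ + Q.coeff m * ψ₁) := by
  have h (n : ℕ) : (derivative Q).coeff n = (n + 1 : ℂ) • Q.coeff (n + 1) := by
    rw [coeff_derivative, mul_add, mul_one, add_smul, one_smul, Nat.cast_smul_eq_nsmul,
      nsmul_eq_mul']
  simp only [raise, mul_add, ← mul_assoc, coeff_add, coeff_mul_C, coeff_mul_X, h, smul_mul_assoc]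
  congr 3
  push_cast
  ring

lemma coeff_raise_zero {φ₀ φ₁ ψ₀ ψ₁ : Mat N} (Q : Polynomial (Mat N)) :
    (raise φ₀ φ₁ ψ₀ ψ₁ Q).coeff 0 = Q.coeff 1 * φ₀ + Q.coeff 0 * ψ₀ := by
  simp [raise, mul_add, ← mul_assoc, coeff_derivative]

/-! ### The zeroth moment -/

variable {α δ δ' : ℕ → ℝ} {c d : ℝ}

lemma gaussInt_X_mul_polyM (hα : ∀ i < N, α (i + 1) ≠ 0) (δ : ℕ → ℝ) :
    gaussInt (X * polyM N α δ) = (1 / 2 : ℂ) • (matAα N α * gaussInt (polyM N α δ) +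
      gaussInt (polyM N α δ) * star (matAα N α)) := by
  have h := gaussInt_derivative (polyM N α δ)
  rw [derivative_polyM hα, map_add, gaussInt_C_mul, gaussInt_mul_C] at h
  rw [h, smul_smul]
  norm_num

lemma gaussInt_linear_mul (a b : Mat N) (F : Polynomial (Mat N)) :
    gaussInt ((C a + C b * X) * F) = a * gaussInt F + b * gaussInt (X * F) := by
  rw [add_mul, map_add, gaussInt_C_mul, mul_assoc, gaussInt_C_mul]

lemma gaussInt_polyM_shift (hα : ∀ i < N, α (i + 1) ≠ 0)
    (hδ : ∀ i < N, δ' (i + 1) = (d * (i + 1) + c) * δ (i + 1)) :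
    gaussInt (polyM N α δ') =
      ((d : ℂ) • matJ N + (c : ℂ) • 1) * gaussInt (polyM N α δ) -
        (d / 2 : ℂ) • (matAα N α * gaussInt (polyM N α δ) * star (matAα N α)) := by
  rw [polyM_shift hα hδ, gaussInt_linear_mul, gaussInt_X_mul_polyM hα, phi0]
  simp only [add_mul, smul_mul_assoc, mul_smul_comm, mul_add, one_mul, smul_add, mul_assoc]
  module

lemma star_gaussInt_polyM (δ : ℕ → ℝ) :
    star (gaussInt (polyM N α δ)) = gaussInt (polyM N α δ) := by
  rw [← gaussInt_adj, adj_polyM]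

/-- Apply the shift formula with c = 0, d = 1, to the auxiliary sequence iδ_i. Every term other than
J times the moment is Hermitian, hence so is that product, and J commutes with the moment. Distinct
entries of J then make the moment diagonal. -/
lemma matJ_mul_gaussInt_polyM (hα : ∀ i < N, α (i + 1) ≠ 0) (δ : ℕ → ℝ) :
    matJ N * gaussInt (polyM N α δ) = gaussInt (polyM N α δ) * matJ N := by
  have h := gaussInt_polyM_shift (δ := δ) (δ' := fun i => i * δ i) (c := 0) (d := 1) hα
    fun i _ => by push_cast; ring
  have h' := congrArg star h
  have hJ : star (matJ N) = matJ N := by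
    rw [matJ_eq, star_dg]
    exact dg_congr fun i _ => by simp
  simp only [star_sub, star_smul, star_mul, star_gaussInt_polyM, star_star, hJ,
    Complex.ofReal_one, Complex.ofReal_zero, one_smul, zero_smul, add_zero] at h h'
  have hs : star (1 / 2 : ℂ) = 1 / 2 := by
    rw [show (1 / 2 : ℂ) = ((1 / 2 : ℝ) : ℂ) by push_cast; rfl]
    exact Complex.conj_ofReal _
  rw [hs, h, ← mul_assoc] at h'
  exact sub_left_inj.1 h'

/-- The diagonal of the zeroth moment of the weight. -/
def momentDiag (N : ℕ) (α δ : ℕ → ℝ) (i : ℕ) : ℂ :=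
  if h : i < N then gaussInt (polyM N α δ) ⟨i, h⟩ ⟨i, h⟩ else 0

lemma gaussInt_polyM_eq (hα : ∀ i < N, α (i + 1) ≠ 0) (δ : ℕ → ℝ) :
    gaussInt (polyM N α δ) = dg N (momentDiag N α δ) := by
  ext i j
  simp only [dg, Matrix.diagonal_apply]
  split_ifs with hij
  · subst hij
    simp [momentDiag]
  · have h := congrFun (congrFun (matJ_mul_gaussInt_polyM hα δ) i) j
    rw [matJ, Matrix.diagonal_mul, Matrix.mul_diagonal, mul_comm, ← sub_eq_zero, ← mul_sub] at h
    refine (mul_eq_zero.1 h).resolve_right fun h' => hij (Fin.ext ?_)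
    rw [add_sub_add_right_eq_sub, sub_eq_zero] at h'
    exact_mod_cast h'

/-- The first row of A vanishes, so E₁₁L^α = E₁₁ and the corner entry of M is the constant δ₁. -/
lemma momentDiag_zero (hN : 0 < N) (hα : ∀ i < N, α (i + 1) ≠ 0) (δ : ℕ → ℝ) :
    momentDiag N α δ 0 = gaussMoment 0 * δ 1 := by
  set e : Mat N := dg N fun i => if i = 0 then 1 else 0 with he
  have hea : e * matAα N α = 0 := by
    rw [matAα_eq hα, he, dg_mul_subDg]
    ext i j
    simp [subDg]
  have heL : C e * polyL N α = C e := by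
    rw [polyL, powSum, Finset.mul_sum, Finset.sum_eq_single 0]
    · simp [cHermite, scaledHermite_zero]
    · intro n _ hn
      obtain ⟨n, rfl⟩ := Nat.exists_eq_succ_of_ne_zero hn
      rw [mul_smul_comm, pow_succ', ← mul_assoc, ← C_mul, hea, C_0, zero_mul, smul_zero]
    · intro h
      exact absurd (Finset.mem_range.2 hN) h
  have hse : star e = e := by
    rw [he, star_dg]
    exact dg_congr fun i _ => by split_ifs <;> simp
  have heL' : adj (polyL N α) * C e = C e := by
    have h := congrArg adj heL
    rwa [adj_mul, adj_C, hse] at h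
  have h : C e * polyM N α δ * C e = C (e * matDelta N δ * e) := by
    rw [polyM, mul_assoc, mul_assoc, mul_assoc, heL', ← mul_assoc, ← mul_assoc, heL, C_mul, C_mul]
  have h' := congrArg gaussInt h
  rw [gaussInt_mul_C, gaussInt_C_mul, gaussInt_C, gaussInt_polyM_eq hα, he, matDelta_eq, dg_mul_dg,
    dg_mul_dg, dg_mul_dg, dg_mul_dg, smul_dg] at h'
  simpa using eq_of_dg_eq h' hN

/-- Integrating the second Pearson equation gives zero on the left. Expressing the first moment
through the zeroth moment H cancels the A H terms and leaves (1/2) U H = (N + 1 - J + r) H A^*, an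
identity of superdiagonal matrices. -/
lemma momentDiag_succ (hα : ∀ i < N, α (i + 1) ≠ 0) (hd : d ≠ 0) {r : ℝ} (hr : r = c / d)
    (hδ : ∀ i < N, δ' (i + 1) = (d * (i + 1) + c) * δ (i + 1))
    (hrec : ∀ i, i + 1 < N → δ' (i + 1) * (α (i + 2) / α (i + 1)) =
      d / 2 * ((i + 1) * (N - (i + 1)) * (α (i + 1) / α (i + 2))) * δ (i + 2))
    {i : ℕ} (hi : i + 1 < N) :
    ((i + 1) * (N - (i + 1)) : ℂ) * momentDiag N α δ (i + 1) =
      2 * (N + r - i) * (α (i + 2) / α (i + 1)) ^ 2 * momentDiag N α δ i := by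
  have h := congrArg gaussInt (polyM_pearson hα hd hr hδ hrec)
  rw [map_sub, map_smul, gaussInt_derivative, sub_self, gaussInt_linear_mul,
    gaussInt_X_mul_polyM hα, psi0] at h
  have h1 : (d : ℂ) • ((1 / 2 : ℂ) • (matU N α * gaussInt (polyM N α δ)) -
      shiftJ N r * (gaussInt (polyM N α δ) * star (matAα N α))) = 0 := by
    rw [h]
    simp only [add_mul, smul_mul_assoc, mul_smul_comm, mul_add, smul_add, mul_assoc]
    module
  have h2 := (smul_eq_zero.1 h1).resolve_left (Complex.ofReal_ne_zero.2 hd)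
  rw [sub_eq_zero, gaussInt_polyM_eq hα, star_matAα hα, matU_eq hα, shiftJ_eq, supDg_mul_dg,
    smul_supDg, dg_mul_supDg, dg_mul_supDg] at h2
  have h3 := eq_of_supDg_eq h2 hi
  have ha1 : (α (i + 1) : ℂ) ≠ 0 := Complex.ofReal_ne_zero.2 (hα i (by omega))
  have ha2 : (α (i + 2) : ℂ) ≠ 0 := Complex.ofReal_ne_zero.2 (hα (i + 1) hi)
  field_simp at h3 ⊢
  linear_combination h3

/-- The integrated first Pearson equation involves the entries i and i - 1; `momentDiag_succ`
eliminates the latter. -/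
lemma momentDiag_shift (hα : ∀ i < N, α (i + 1) ≠ 0) (hd : d ≠ 0) {r : ℝ} (hr : r = c / d)
    (hδ : ∀ i < N, δ' (i + 1) = (d * (i + 1) + c) * δ (i + 1))
    (hrec : ∀ i, i + 1 < N → δ' (i + 1) * (α (i + 2) / α (i + 1)) =
      d / 2 * ((i + 1) * (N - (i + 1)) * (α (i + 1) / α (i + 2))) * δ (i + 2))
    {i : ℕ} (hi : i < N) :
    (N + 1 + r - i : ℂ) * momentDiag N α δ' i =
      d * (1 + r) * (N + 1 + r) * momentDiag N α δ i := by
  have h := gaussInt_polyM_shift (c := c) (d := d) hα hδ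
  rw [gaussInt_polyM_eq hα, gaussInt_polyM_eq hα, star_matAα hα, matAα_eq hα, subDg_mul_dg,
    subDg_mul_supDg, matJ_eq, ← dg_one, smul_dg, smul_dg, dg_add, dg_mul_dg, smul_dg, dg_sub] at h
  have h1 := eq_of_dg_eq h hi
  have hcr : (c : ℂ) = d * r := by
    rw [hr]
    push_cast
    field_simp [Complex.ofReal_ne_zero.2 hd]
  rcases i with _ | i
  · simp only [if_true] at h1
    rw [h1, hcr]
    push_cast
    ring
  · rw [if_neg (by omega), Nat.add_sub_cancel] at h1
    have h2 := momentDiag_succ hα hd hr hδ hrec hi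
    rw [h1, hcr]
    push_cast
    linear_combination (d : ℂ) * h2

lemma momentDiag_ne_zero (hN : 0 < N) (hα : ∀ i < N, α (i + 1) ≠ 0) (hd : 0 < d) (hc : 0 < c)
    (hδ1 : δ 1 ≠ 0) (hδ : ∀ i < N, δ' (i + 1) = (d * (i + 1) + c) * δ (i + 1))
    (hrec : ∀ i, i + 1 < N → δ' (i + 1) * (α (i + 2) / α (i + 1)) =
      d / 2 * ((i + 1) * (N - (i + 1)) * (α (i + 1) / α (i + 2))) * δ (i + 2))
    {i : ℕ} (hi : i < N) : momentDiag N α δ i ≠ 0 := by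
  induction i with
  | zero =>
    rw [momentDiag_zero hN hα]
    exact mul_ne_zero (Complex.ofReal_ne_zero.2 gaussMoment_zero_pos.ne')
      (Complex.ofReal_ne_zero.2 hδ1)
  | succ i ih =>
    have h := momentDiag_succ hα hd.ne' rfl hδ hrec hi
    intro h0
    rw [h0, mul_zero] at h
    have ha1 : (α (i + 1) : ℂ) ≠ 0 := Complex.ofReal_ne_zero.2 (hα i (by omega))
    have ha2 : (α (i + 2) : ℂ) ≠ 0 := Complex.ofReal_ne_zero.2 (hα (i + 1) hi)
    have hp : (0 : ℝ) < N + c / d - i := by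
      have h1 : ((i + 1 : ℕ) : ℝ) < N := Nat.cast_lt.2 hi
      push_cast at h1
      have := div_pos hc hd
      linarith
    have hp' : (N + (c / d : ℝ) - i : ℂ) ≠ 0 := by exact_mod_cast hp.ne'
    exact mul_ne_zero (mul_ne_zero (mul_ne_zero two_ne_zero hp') (pow_ne_zero 2 (div_ne_zero ha2 ha1)))
      (ih (by omega)) h.symm

end MVHermite

end

noncomputable section

namespace MVHermite

open Polynomial MeasureTheory

local notation "Mat" N => Matrix (Fin N) (Fin N) ℂ

/-! ### The orthogonal polynomials -/

/-- The parameters of a sequence of matrix weights that are related by Pearson equations. -/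
structure PearsonFamily (N : ℕ) (α : ℕ → ℝ) (δ : ℕ → ℕ → ℝ) (c d : ℕ → ℝ) : Prop where
  size_pos : 0 < N
  alpha_ne : ∀ i < N, α (i + 1) ≠ 0
  c_pos : ∀ k, 0 < c k
  d_pos : ∀ k, 0 < d k
  delta_pos : ∀ k, ∀ i < N, 0 < δ k (i + 1)
  delta_succ : ∀ k, ∀ i < N, δ (k + 1) (i + 1) = (d k * (i + 1) + c k) * δ k (i + 1)
  alpha_rec : ∀ k i, i + 1 < N → α (i + 2) ^ 2 / α (i + 1) ^ 2 =
    d k * (i + 1) * (N - (i + 1)) / (2 * (d k * (i + 1) + c k)) * (δ k (i + 2) / δ k (i + 1))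

/-- The monic orthogonal polynomials, built by iterating the raising operators. -/
def raisedPoly (N : ℕ) (α : ℕ → ℝ) (c d : ℕ → ℝ) : ℕ → ℕ → Polynomial (Mat N)
  | 0, _ => 1
  -- The prefactor inverts the leading coefficient -2d(N + 1 - J + c/d) of Ψ, since Q'Φ does not
  -- reach the top degree.
  | n + 1, k => C (-(1 / (2 * d k) : ℂ) • (shiftJ N (c k / d k))⁻¹) *
      raise (phi0 N α (c k) (d k)) (-(d k : ℂ) • matAα N α) ((d k : ℂ) • psi0 N α (c k / d k))
        (-(2 * d k : ℂ) • shiftJ N (c k / d k)) (raisedPoly N α c d n (k + 1))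

/-- The diagonal of the squared norm of the orthogonal polynomials. -/
def normDiag (N : ℕ) (α : ℕ → ℝ) (δ : ℕ → ℕ → ℝ) (c d : ℕ → ℝ) : ℕ → ℕ → ℕ → ℂ
  | 0, k => momentDiag N α (δ k)
  | n + 1, k => fun i => (n + 1) / (2 * d k) * (N + (c k / d k : ℝ) - i : ℂ)⁻¹ *
      normDiag N α δ c d n (k + 1) i

/-- The first recurrence coefficient `B₀`. -/
def coeffB (N : ℕ) (α : ℕ → ℝ) (r : ℝ) : Mat N :=
  (1 / 2 : ℂ) • matAα N α + (1 / 4 : ℂ) • ((shiftJ N r)⁻¹ * matU N α)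

lemma shift_pos {N i : ℕ} (hi : i < N) {r : ℝ} (hr : 0 < r) : 0 < (N : ℝ) + r - i := by
  have : (i : ℝ) < N := Nat.cast_lt.2 hi
  linarith

lemma shift_ne_zero {N i : ℕ} (hi : i < N) {r : ℝ} (hr : 0 < r) : (N + r - i : ℂ) ≠ 0 := by
  have := (shift_pos hi hr).ne'
  exact_mod_cast this

lemma shiftJ_inv {N : ℕ} {r : ℝ} (hr : 0 < r) :
    (shiftJ N r)⁻¹ = dg N fun i => (N + r - i : ℂ)⁻¹ := by
  rw [shiftJ_eq, dg_inv fun i hi => shift_ne_zero hi hr]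

lemma shiftJ_inv_mul {N : ℕ} {r : ℝ} (hr : 0 < r) : (shiftJ N r)⁻¹ * shiftJ N r = 1 := by
  rw [shiftJ_inv hr, shiftJ_eq, dg_mul_dg, ← dg_one]
  exact dg_congr fun i hi => inv_mul_cancel₀ (shift_ne_zero hi hr)

lemma coeffB_eq {N : ℕ} {α : ℕ → ℝ} (hα : ∀ i < N, α (i + 1) ≠ 0) {r : ℝ} (hr : 0 < r) :
    coeffB N α r = subDg N (fun j => (α (j + 2) / α (j + 1) : ℂ)) + supDg N fun i =>
      1 / 2 * ((N + r - i : ℂ)⁻¹ * ((i + 1) * (N - (i + 1)) * (α (i + 1) / α (i + 2)))) := by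
  rw [coeffB, matAα_eq hα, matU_eq hα, shiftJ_inv hr, dg_mul_supDg, smul_supDg, smul_subDg]
  congr 1
  · exact subDg_congr fun i _ => by ring
  · exact supDg_congr fun i _ => by ring

namespace PearsonFamily

variable {N : ℕ} {α : ℕ → ℝ} {δ : ℕ → ℕ → ℝ} {c d : ℕ → ℝ}

lemma ratio_pos (F : PearsonFamily N α δ c d) (k : ℕ) : 0 < c k / d k :=
  div_pos (F.c_pos k) (F.d_pos k)

lemma delta_rec (F : PearsonFamily N α δ c d) (k i : ℕ) (hi : i + 1 < N) :
    δ (k + 1) (i + 1) * (α (i + 2) / α (i + 1)) =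
      d k / 2 * ((i + 1) * (N - (i + 1)) * (α (i + 1) / α (i + 2))) * δ k (i + 2) := by
  have h := F.alpha_rec k i hi
  have ha1 := F.alpha_ne i (by omega)
  have ha2 := F.alpha_ne (i + 1) hi
  have hd1 := (F.delta_pos k i (by omega)).ne'
  have hp : d k * (i + 1) + c k ≠ 0 := by
    have := F.d_pos k
    have := F.c_pos k
    positivity
  rw [F.delta_succ k i (by omega)]
  simp only [add_assoc, one_add_one_eq_two] at ha2
  field_simp at h ⊢
  linear_combination h

/-- The quotient α₂²/α₁² does not depend on the parameter. Comparing its two expressions at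
consecutive parameters, and inserting the recursion for δ₁ and δ₂, gives (d' + c')/d' = (2d + c)/d.
-/
lemma ratio_succ (F : PearsonFamily N α δ c d) (hN : 1 < N) (k : ℕ) :
    c (k + 1) / d (k + 1) = c k / d k + 1 := by
  have h0 := F.alpha_rec k 0 hN
  have h1 := F.alpha_rec (k + 1) 0 hN
  rw [h0] at h1
  have e1 := F.delta_succ k 0 (by omega)
  have e2 := F.delta_succ k 1 hN
  have p1 := F.delta_pos k 0 (by omega)
  have p2 := F.delta_pos k 1 hN
  have hd := F.d_pos k
  have hc := F.c_pos k
  have hd' := F.d_pos (k + 1)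
  have hc' := F.c_pos (k + 1)
  have hNr : (0 : ℝ) < N - 1 := by
    have : ((1 : ℕ) : ℝ) < N := Nat.cast_lt.2 hN
    push_cast at this
    linarith
  norm_num at h1 e1 e2 p1 p2
  rw [e1, e2] at h1
  have n1 : d k + c k ≠ 0 := by positivity
  have n2 : d (k + 1) + c (k + 1) ≠ 0 := by positivity
  field_simp at h1
  field_simp
  nlinarith [h1]

lemma isOrthoSeq_step (F : PearsonFamily N α δ c d) (n k : ℕ) :
    MonicOfDegree n (raisedPoly N α c d n k) ∧
    (∀ j < n, gaussInt (raisedPoly N α c d n k * polyM N α (δ k) * X ^ j) = 0) ∧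
    gaussInt (raisedPoly N α c d n k * polyM N α (δ k) * X ^ n) =
      dg N (normDiag N α δ c d n k) := by
  induction n generalizing k with
  | zero =>
    refine ⟨⟨by simp [raisedPoly], fun j hj => ?_⟩, by simp, ?_⟩
    · simp [raisedPoly, coeff_one, hj.ne']
    · rw [raisedPoly, one_mul, pow_zero, mul_one, gaussInt_polyM_eq F.alpha_ne, normDiag]
  | succ n ih =>
    obtain ⟨hm, ho, hn⟩ := ih (k + 1)
    have hd : (d k : ℂ) ≠ 0 := Complex.ofReal_ne_zero.2 (F.d_pos k).ne'
    have h1 := polyM_shift (N := N) F.alpha_ne (F.delta_succ k)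
    have h2 := polyM_pearson F.alpha_ne (F.d_pos k).ne' rfl (F.delta_succ k) (F.delta_rec k)
    -- Pairings with x^j at k are multiples of pairings with x^{j-1} at k + 1, so orthogonality and
    -- the norm are both inherited.
    have key (j : ℕ) : gaussInt (raisedPoly N α c d (n + 1) k * polyM N α (δ k) * X ^ j) =
        (j / (2 * d k) : ℂ) • ((shiftJ N (c k / d k))⁻¹ *
          gaussInt (raisedPoly N α c d n (k + 1) * polyM N α (δ (k + 1)) * X ^ (j - 1))) := by
      rw [raisedPoly, mul_assoc, mul_assoc, gaussInt_C_mul, ← mul_assoc, gaussInt_raise h1 h2,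
        smul_mul_assoc, mul_smul_comm, smul_smul]
      congr 1
      field_simp
    refine ⟨⟨?_, fun j hj => ?_⟩, fun j hj => ?_, ?_⟩
    · rw [raisedPoly, coeff_C_mul, coeff_raise_succ, hm.1, hm.2 (n + 2) (by omega),
        hm.2 (n + 1) (by omega)]
      simp only [zero_mul, smul_zero, zero_add, one_mul, smul_mul_assoc, mul_smul_comm, smul_smul,
        shiftJ_inv_mul (F.ratio_pos k)]
      rw [show -(2 * d k : ℂ) * -(1 / (2 * d k)) = 1 by field_simp, one_smul]
    · obtain ⟨j, rfl⟩ : ∃ l, j = l + 1 := ⟨j - 1, by omega⟩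
      rw [raisedPoly, coeff_C_mul, coeff_raise_succ, hm.2 j (by omega), hm.2 (j + 2) (by omega),
        hm.2 (j + 1) (by omega)]
      simp
    · rw [key]
      rcases j with _ | j
      · simp
      · rw [Nat.add_sub_cancel, ho j (by omega), mul_zero, smul_zero]
    · rw [key, Nat.add_sub_cancel, hn, shiftJ_inv (F.ratio_pos k), dg_mul_dg, smul_dg, normDiag]
      exact dg_congr fun i _ => by push_cast; ring

lemma normDiag_ne_zero (F : PearsonFamily N α δ c d) (n k : ℕ) {i : ℕ} (hi : i < N) :
    normDiag N α δ c d n k i ≠ 0 := by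
  induction n generalizing k with
  | zero =>
    exact momentDiag_ne_zero F.size_pos F.alpha_ne (F.d_pos k) (F.c_pos k)
      (F.delta_pos k 0 F.size_pos).ne' (F.delta_succ k) (F.delta_rec k) hi
  | succ n ih =>
    rw [normDiag]
    have hd : (d k : ℂ) ≠ 0 := Complex.ofReal_ne_zero.2 (F.d_pos k).ne'
    exact mul_ne_zero (mul_ne_zero (div_ne_zero (by exact_mod_cast n.succ_ne_zero)
      (mul_ne_zero two_ne_zero hd)) (inv_ne_zero (shift_ne_zero hi (F.ratio_pos k)))) (ih _)

lemma isOrthoSeq (F : PearsonFamily N α δ c d) (k : ℕ) :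
    IsOrthoSeq (polyM N α (δ k)) (fun n => raisedPoly N α c d n k)
      (fun n => dg N (normDiag N α δ c d n k)) where
  monic n := (F.isOrthoSeq_step n k).1
  ortho n := (F.isOrthoSeq_step n k).2.1
  norm n := (F.isOrthoSeq_step n k).2.2
  unit n := isUnit_dg fun _ hi => F.normDiag_ne_zero n k hi

lemma normDiag_step (n k i : ℕ) : normDiag N α δ c d (n + 1) k i =
    (n + 1) / (2 * d k) * (N + (c k / d k : ℝ) - i : ℂ)⁻¹ * normDiag N α δ c d n (k + 1) i := rfl

/-- The ratio of consecutive squared norms. -/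
lemma normDiag_succ (F : PearsonFamily N α δ c d) (n k : ℕ) {i : ℕ} (hi : i < N) :
    normDiag N α δ c d (n + 1) k i =
      ((n + 1) * (1 + (c (k + n) / d (k + n) : ℝ)) * (N + 1 + (c (k + n) / d (k + n) : ℝ)) /
        (2 * (N + (c (k + n) / d (k + n) : ℝ) - i) * (N + 1 + (c (k + n) / d (k + n) : ℝ) - i)) *
        normDiag N α δ c d n k i : ℂ) := by
  induction n generalizing k with
  | zero =>
    have h := momentDiag_shift F.alpha_ne (F.d_pos k).ne' rfl (F.delta_succ k) (F.delta_rec k) hi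
    have hd : (d k : ℂ) ≠ 0 := Complex.ofReal_ne_zero.2 (F.d_pos k).ne'
    have h1 := shift_ne_zero hi (F.ratio_pos k)
    have h2 := shift_ne_zero (i := i) (N := N + 1) (by omega) (F.ratio_pos k)
    rw [Nat.cast_add, Nat.cast_one] at h2
    simp only [normDiag, add_zero]
    generalize c k / d k = r at h h1 h2 ⊢
    field_simp
    linear_combination h
  | succ n ih =>
    have hn : (n + 1 : ℂ) ≠ 0 := by exact_mod_cast n.succ_ne_zero
    -- Both norms acquire the same diagonal prefactor, up to n + 2 against n + 1, so the ratio
    -- depends on k and n otherwise only through k + n.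
    rw [normDiag_step, ih (k + 1), normDiag_step, show k + 1 + n = k + (n + 1) by ring]
    generalize (((c (k + (n + 1)) / d (k + (n + 1)) : ℝ)) : ℂ) = r
    generalize normDiag N α δ c d n (k + 1) i = z
    generalize (N + ((c k / d k : ℝ) : ℂ) - i : ℂ)⁻¹ = y
    push_cast
    field_simp

/-- The subleading coefficient of the orthogonal polynomials. -/
lemma coeff_raisedPoly (F : PearsonFamily N α δ c d) (n k : ℕ) :
    (raisedPoly N α c d (n + 1) k).coeff n =
      -(n + 1 : ℂ) • coeffB N α (c (k + n) / d (k + n)) := by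
  induction n generalizing k with
  | zero =>
    have hd : (d k : ℂ) ≠ 0 := Complex.ofReal_ne_zero.2 (F.d_pos k).ne'
    rw [raisedPoly, coeff_C_mul, coeff_raise_zero, raisedPoly, coeff_one, coeff_one, if_neg (by omega),
      if_pos rfl, zero_mul, one_mul, zero_add, psi0, add_zero, coeffB, smul_mul_smul_comm, mul_add,
      ← mul_assoc, shiftJ_inv_mul (F.ratio_pos k), one_mul, mul_smul_comm]
    rw [show -(1 / (2 * d k) : ℂ) * d k = -(1 / 2) by field_simp]
    module
  | succ n ih =>
    have hd : (d k : ℂ) ≠ 0 := Complex.ofReal_ne_zero.2 (F.d_pos k).ne'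
    have hm := (F.isOrthoSeq_step (n + 1) (k + 1)).1
    have hr := F.ratio_pos k
    have hr' := F.ratio_pos (k + (n + 1))
    -- Only superdiagonal entries use this, and they exist only for N > 1.
    have hrr : 1 < N → c (k + (n + 1)) / d (k + (n + 1)) = c k / d k + (n + 1) := by
      intro hN
      clear ih hm hr'
      induction n with
      | zero => simpa using F.ratio_succ hN k
      | succ n ih =>
        rw [← add_assoc k, F.ratio_succ hN, ih]
        push_cast
        ring
    rw [raisedPoly, coeff_C_mul, coeff_raise_succ, hm.1, hm.2 (n + 2) (by omega), ih,
      show k + 1 + n = k + (n + 1) by ring, psi0, coeffB_eq F.alpha_ne hr', shiftJ_inv hr,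
      shiftJ_eq, matAα_eq F.alpha_ne, matU_eq F.alpha_ne]
    simp only [zero_mul, smul_zero, zero_add, one_mul, smul_add, smul_mul_assoc, mul_smul_comm,
      add_mul, mul_add, subDg_mul_dg, supDg_mul_dg, dg_mul_subDg, dg_mul_supDg, smul_subDg,
      smul_supDg]
    generalize c (k + (n + 1)) / d (k + (n + 1)) = R at *
    generalize c k / d k = r at *
    -- Collect the subdiagonal terms and the superdiagonal terms, to compare them separately.
    rw [show ∀ a b c d e : Mat N, a + (b + c + (d + e)) = (a + b + d) + (c + e) from
      fun a b c d e => by abel]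
    simp only [subDg_add, supDg_add]
    congr 1
    · refine subDg_congr fun i hi => ?_
      have h1 := shift_ne_zero hi hr
      push_cast at h1 ⊢
      generalize (α (i + 2) / α (i + 1) : ℂ) = t
      field_simp
      ring
    · refine supDg_congr fun i hi => ?_
      have h1 := shift_ne_zero (N := N) (i := i) (by omega) hr
      have h2 := shift_ne_zero (N := N) (i := i) (by omega) hr'
      have h3 := hrr (by omega)
      rw [h3] at h2 ⊢
      push_cast at h2 ⊢
      generalize (α (i + 1) / α (i + 2) : ℂ) = t
      field_simp
      ring

end PearsonFamily

end MVHermite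

end

/-! ### Pochhammer quotients and the explicit recurrence coefficients -/

noncomputable section

namespace MVHermite

open Polynomial

local notation "Mat" N => Matrix (Fin N) (Fin N) ℂ

lemma ascPochhammer_eval_neg_ne_zero {N p : ℕ} (hp : p ≤ N) {r : ℝ} (hr : 0 < r) :
    (ascPochhammer ℝ p).eval (-(N : ℝ) - r) ≠ 0 := by
  induction p with
  | zero => simp
  | succ p ih =>
    rw [ascPochhammer_succ_eval]
    refine mul_ne_zero (ih (by omega)) fun h => ?_
    have := shift_pos (N := N) (i := p) (by omega) hr
    linarith

/-- With r' = r + 1 the two products share all but boundary factors. At p = 0 the numerator is the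
empty product, so r' is irrelevant; this covers N = 1, where r' = r + 1 may fail. -/
lemma ascPochhammer_ratio {N p : ℕ} (hp : p < N) {r r' : ℝ} (hr : 0 < r)
    (h : 0 < p → r' = r + 1) :
    (ascPochhammer ℝ p).eval (-(N : ℝ) - r') / (ascPochhammer ℝ (p + 1)).eval (-(N : ℝ) - r) =
      -(N + 1 + r) / ((N + r - p) * (N + 1 + r - p)) := by
  have h1 := shift_pos hp hr
  rcases p.eq_zero_or_pos with rfl | hp0
  · have : (0 : ℝ) ≤ N := N.cast_nonneg
    have h2 : (N + r : ℝ) ≠ 0 := by positivity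
    have h3 : (-N - r : ℝ) ≠ 0 := by
      rw [← neg_add']
      exact neg_ne_zero.2 h2
    have h4 : (N + 1 + r : ℝ) ≠ 0 := by positivity
    simp only [ascPochhammer_zero, eval_one, zero_add, ascPochhammer_one, eval_X, Nat.cast_zero,
      sub_zero]
    field_simp
    ring
  · have h2 : (N + 1 + r - p : ℝ) ≠ 0 := by linarith
    have h3 := ascPochhammer_eval_neg_ne_zero (p := p) hp.le hr
    have h4 : (-N - r + p : ℝ) ≠ 0 := by linarith
    have e1 := ascPochhammer_succ_eval p (-(N : ℝ) - (r + 1))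
    rw [ascPochhammer_succ_left, eval_mul, eval_X, eval_comp, eval_add, eval_X, eval_one,
      show -(N : ℝ) - (r + 1) + 1 = -N - r by ring] at e1
    rw [h hp0, ascPochhammer_succ_eval, div_eq_div_iff (mul_ne_zero h3 h4)
      (mul_ne_zero h1.ne' h2)]
    linear_combination (N + r - p : ℝ) * e1

lemma coeffB_apply_eq_zero {N : ℕ} {α : ℕ → ℝ} (hα : ∀ i < N, α (i + 1) ≠ 0) {r : ℝ} (hr : 0 < r)
    {i j : Fin N} (h1 : (i : ℕ) ≠ (j : ℕ) + 1) (h2 : (j : ℕ) ≠ (i : ℕ) + 1) :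
    coeffB N α r i j = 0 := by
  rw [coeffB_eq hα hr]
  simp [subDg, supDg, h1, h2]

/-- Partial fractions: with G_t = N + 1 - J + t, the triple product is (n+1)G_s⁻¹ - nG_r⁻¹. -/
lemma coeffB_comb {N : ℕ} {α : ℕ → ℝ} {r s : ℝ} (hr : 0 < r) (hs : 0 < s) (n : ℝ) :
    -(n : ℂ) • coeffB N α r - -(n + 1 : ℂ) • coeffB N α s =
      (1 / 2 : ℂ) • matAα N α + (1 / 4 : ℂ) •
        ((shiftJ N r)⁻¹ * (shiftJ N s)⁻¹ * shiftJ N ((n + 1) * r - n * s) * matU N α) := by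
  have h : (shiftJ N r)⁻¹ * (shiftJ N s)⁻¹ * shiftJ N ((n + 1) * r - n * s) =
      (n + 1 : ℂ) • (shiftJ N s)⁻¹ - (n : ℂ) • (shiftJ N r)⁻¹ := by
    rw [shiftJ_inv hr, shiftJ_inv hs, shiftJ_eq, dg_mul_dg, dg_mul_dg, smul_dg, smul_dg, dg_sub]
    refine dg_congr fun i hi => ?_
    have h1 := shift_ne_zero hi hr
    have h2 := shift_ne_zero hi hs
    push_cast
    field_simp
    ring
  rw [h, coeffB, coeffB, sub_mul, smul_mul_assoc, smul_mul_assoc]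
  module

namespace PearsonFamily

variable {N : ℕ} {α : ℕ → ℝ} {δ : ℕ → ℕ → ℝ} {c d : ℕ → ℝ}

lemma norm_ratio (F : PearsonFamily N α δ c d) (n k : ℕ) :
    dg N (normDiag N α δ c d (n + 1) k) * (dg N (normDiag N α δ c d n k))⁻¹ =
      Matrix.diagonal fun p : Fin N =>
        (((-((n + 1 : ℕ) : ℝ) / (2 * d (k + n))) * (δ (k + n + 1) 1 / δ (k + n) 1) *
          ((ascPochhammer ℝ (p : ℕ)).eval (-(N : ℝ) - c (k + n + 1) / d (k + n + 1)) /
            (ascPochhammer ℝ ((p : ℕ) + 1)).eval (-(N : ℝ) - c (k + n) / d (k + n))) : ℝ) : ℂ) := by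
  rw [dg_inv fun i hi => F.normDiag_ne_zero n k hi, dg_mul_dg, dg]
  congr 1
  funext p
  have hr := F.ratio_pos (k + n)
  have hδ := F.delta_succ (k + n) 0 F.size_pos
  have hδ0 := (F.delta_pos (k + n) 0 F.size_pos).ne'
  have hd := (F.d_pos (k + n)).ne'
  -- The left side is the quotient of consecutive δ₁, which accounts for the factor 1 + r in the
  -- norm ratio.
  have hrat : d (k + n) + c (k + n) = d (k + n) * (1 + c (k + n) / d (k + n)) := by field_simp
  simp only [Nat.cast_zero, zero_add, mul_one] at hδ hδ0
  rw [F.normDiag_succ n k p.2, mul_assoc, mul_inv_cancel₀ (F.normDiag_ne_zero n k p.2), mul_one,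
    ascPochhammer_ratio p.2 hr fun hp => F.ratio_succ (by have := p.2; omega) (k + n), hδ,
    mul_div_cancel_right₀ _ hδ0, hrat]
  generalize c (k + n) / d (k + n) = r at hr ⊢
  have hdC : (d (k + n) : ℂ) ≠ 0 := Complex.ofReal_ne_zero.2 hd
  have h1 := shift_ne_zero p.2 hr
  have h2 := shift_ne_zero (N := N + 1) (i := p) (by omega) hr
  push_cast at h2 ⊢
  field_simp

end PearsonFamily

end MVHermite

end

/-! ### The main theorem -/

theorem mainTheorem4 (N : ℕ) (hN : 1 ≤ N) (ν₀ : ℝ) (α : ℕ → ℝ) (δ : ℝ → ℕ → ℝ) (c d : ℝ → ℝ)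
    (hα : ∀ i : ℕ, 1 ≤ i → i ≤ N → α i ≠ 0) (hα1 : α 1 = 1)
    (hδ : ∀ (k i : ℕ), 1 ≤ i → i ≤ N → 0 < δ (ν₀ + k) i)
    (hc : ∀ k : ℕ, 0 < c (ν₀ + k)) (hd : ∀ k : ℕ, 0 < d (ν₀ + k))
    (hΔ : ∀ (k i : ℕ), 1 ≤ i → i ≤ N →
      δ (ν₀ + k + 1) i = (d (ν₀ + k) * i + c (ν₀ + k)) * δ (ν₀ + k) i)
    (hrec : ∀ (k i : ℕ), 1 ≤ i → i + 1 ≤ N →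
      α (i + 1) ^ 2 / α i ^ 2 =
        d (ν₀ + k) * i * (N - i) / (2 * (d (ν₀ + k) * i + c (ν₀ + k))) *
          (δ (ν₀ + k) (i + 1) / δ (ν₀ + k) i))
    (ν : ℝ) (hν : ∃ k : ℕ, ν = ν₀ + k) :
    (∃! P : ℕ → Polynomial (Matrix (Fin N) (Fin N) ℂ),
      MVHermite.IsMonicOrthogonal (MVHermite.weight N α (δ ν)) P) ∧
    ∀ P : ℕ → Polynomial (Matrix (Fin N) (Fin N) ℂ),
      MVHermite.IsMonicOrthogonal (MVHermite.weight N α (δ ν)) P →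
      (∀ B : Matrix (Fin N) (Fin N) ℂ,
        Polynomial.X * P 0 = P 1 + Polynomial.C B * P 0 ↔
          B = (1 / 2 : ℂ) • MVHermite.matAα N α +
            (1 / 4 : ℂ) • ((MVHermite.shiftJ N (c ν / d ν))⁻¹ * MVHermite.matU N α)) ∧
      (∀ n : ℕ, 1 ≤ n → ∀ B C : Matrix (Fin N) (Fin N) ℂ,
        Polynomial.X * P n = P (n + 1) + Polynomial.C B * P n + Polynomial.C C * P (n - 1) ↔
          B = (1 / 2 : ℂ) • MVHermite.matAα N α +
            (1 / 4 : ℂ) •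
              ((MVHermite.shiftJ N (c (ν + n - 1) / d (ν + n - 1)))⁻¹ *
                (MVHermite.shiftJ N (c (ν + n) / d (ν + n)))⁻¹ *
                MVHermite.shiftJ N ((n + 1) * (c (ν + n - 1) / d (ν + n - 1)) -
                  n * (c (ν + n) / d (ν + n))) *
                MVHermite.matU N α) ∧
          C = Matrix.diagonal fun p : Fin N =>
            (((-(n : ℝ) / (2 * d (ν + n - 1))) * (δ (ν + n) 1 / δ (ν + n - 1) 1) *
              ((ascPochhammer ℝ (p : ℕ)).eval (-(N : ℝ) - c (ν + n) / d (ν + n)) /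
                (ascPochhammer ℝ ((p : ℕ) + 1)).eval
                  (-(N : ℝ) - c (ν + n - 1) / d (ν + n - 1))) : ℝ) : ℂ)) ∧
      ∀ (n : ℕ) (B C : Matrix (Fin N) (Fin N) ℂ),
        Polynomial.X * P n = P (n + 1) + Polynomial.C B * P n +
          (if n = 0 then 0 else Polynomial.C C * P (n - 1)) →
        ∀ i j : Fin N, (i : ℕ) ≠ (j : ℕ) + 1 → (j : ℕ) ≠ (i : ℕ) + 1 → B i j = 0 := by
  obtain ⟨k, rfl⟩ := hν
  have F : MVHermite.PearsonFamily N α (fun k : ℕ => δ (ν₀ + k)) (fun k : ℕ => c (ν₀ + k))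
      (fun k : ℕ => d (ν₀ + k)) :=
    { size_pos := hN
      alpha_ne := fun i hi => hα (i + 1) (by omega) hi
      c_pos := hc
      d_pos := hd
      delta_pos := fun k i hi => hδ k (i + 1) (by omega) hi
      delta_succ := fun k i hi => by
        have h := hΔ k (i + 1) (by omega) hi
        push_cast at h ⊢
        rwa [← add_assoc]
      alpha_rec := fun k i hi => by
        have h := hrec k (i + 1) (by omega) hi
        push_cast at h
        exact h }
  have : Nonempty (Fin N) := ⟨⟨0, hN⟩⟩
  have hO := F.isOrthoSeq k
  have hM := MVHermite.adj_polyM (N := N) (α := α) (δ (ν₀ + k))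
  have hW := MVHermite.weight_eq (N := N) F.alpha_ne (δ (ν₀ + k))
  refine ⟨⟨_, hO.isMonicOrthogonal hM hW, fun P hP => hO.eq_of_isMonicOrthogonal hM hW hP⟩, ?_⟩
  intro P hP
  -- By uniqueness P is the raised sequence, whose norms and subleading coefficients are known.
  obtain rfl := hO.eq_of_isMonicOrthogonal hM hW hP
  have hB0 : ∀ B : Matrix (Fin N) (Fin N) ℂ, _ := hO.two_term_iff
  have hB : ∀ n : ℕ, ∀ B C : Matrix (Fin N) (Fin N) ℂ, _ := hO.three_term_iff hM
  have e0 := F.coeff_raisedPoly 0 k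
  simp only [F.coeff_raisedPoly, F.norm_ratio] at hB
  refine ⟨fun B => ?_, fun n hn B C => ?_, fun n B C h i j h1 h2 => ?_⟩
  · rw [hB0, e0, ← neg_smul, neg_neg, Nat.cast_zero, zero_add, one_smul, add_zero]
    rfl
  · obtain ⟨m, rfl⟩ : ∃ m, n = m + 1 := ⟨n - 1, by omega⟩
    -- With n = m + 1, the real parameters ν + n - 1 and ν + n are the members k + m and k + m + 1
    -- of the family.
    have c1 : ν₀ + k + ((m + 1 : ℕ) : ℝ) - 1 = ν₀ + ((k + m : ℕ) : ℝ) := by push_cast; ring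
    have c2 : ν₀ + k + ((m + 1 : ℕ) : ℝ) = ν₀ + ((k + m + 1 : ℕ) : ℝ) := by push_cast; ring
    have hcomb := MVHermite.coeffB_comb (N := N) (α := α) (F.ratio_pos (k + m))
      (F.ratio_pos (k + m + 1)) ((m + 1 : ℕ) : ℝ)
    rw [c1, c2, ← hcomb, Nat.add_sub_cancel]
    have h := hB m B C
    rw [← add_assoc k m 1] at h
    push_cast at h ⊢
    exact h
  · have hz (m : ℕ) : MVHermite.coeffB N α (c (ν₀ + m) / d (ν₀ + m)) i j = 0 :=
      MVHermite.coeffB_apply_eq_zero F.alpha_ne (F.ratio_pos m) h1 h2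
    rcases n with _ | m
    · rw [if_pos rfl, add_zero] at h
      rw [(hB0 B).1 h, e0, Matrix.neg_apply, Matrix.smul_apply, hz, smul_zero, neg_zero]
    · rw [if_neg (Nat.succ_ne_zero m), Nat.add_sub_cancel] at h
      rw [((hB m B C).1 h).1, Matrix.sub_apply, Matrix.smul_apply, Matrix.smul_apply, hz, hz, smul_zero,
        smul_zero, sub_zero]
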